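/- Write $(a;q)_n=\prod_{k=0}^{n-1}(1-aq^k)$, $(a;q)_\infty=\prod_{k\ge 0}(1-aq^k)$ and $(a_1,a_2,a_3;q)_\infty=(a_1;q)_\infty(a_2;q)_\infty(a_3;q)_\infty$. For every complex $q$ with $|q|<1$ the following eight identities hold (the triple sums converge absolutely, and all exponents are nonnegative integers). Example 1: $$\sum_{i,j,k\ge 0}\frac{q^{\frac12 i^2+j^2+4k^2+ij+2jk+\frac12 i+j}}{(q;q)_i(q;q)_j(q^2;q^2)_k}=\frac{(q^8,q^{12},q^{20};q^{20})_\infty}{(q;q)_\infty},$$ $$\sum_{i,j,k\ge 0}\frac{q^{\frac12 i^2+j^2+4k^2+ij+2jk+\frac12 i+j+4k}}{(q;q)_i(q;q)_j(q^2;q^2)_k}=\frac{(q^4,q^{16},q^{20};q^{20})_\infty}{(q;q)_\infty}.$$ Example 6: $$\sum_{i,j,k\ge 0}\frac{q^{\frac12 i^2+\frac52 j^2+8k^2+ij+2ik+8jk+\frac12 i-\frac12 j}}{(q;q)_i(q;q)_j(q^2;q^2)_k}=\frac{(q^4,q^6,q^{10};q^{10})_\infty}{(q;q)_\infty},$$ $$\sum_{i,j,k\ge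 0}\frac{q^{\frac12 i^2+\frac52 j^2+8k^2+ij+2ik+8jk+\frac12 i+\frac32 j+4k}}{(q;q)_i(q;q)_j(q^2;q^2)_k}=\frac{(q^2,q^8,q^{10};q^{10})_\infty}{(q;q)_\infty}.$$ Example 7: $$\sum_{i,j,k\ge 0}\frac{q^{\frac12 i^2+4j^2+k^2+ij+2jk+\frac12 i+k}}{(q;q)_i(q;q)_j(q^2;q^2)_k}=\frac{(q^8,q^{12},q^{20};q^{20})_\infty}{(q;q)_\infty},$$ $$\sum_{i,j,k\ge 0}\frac{q^{\frac12 i^2+4j^2+k^2+ij+2jk+\frac12 i+4j+k}}{(q;q)_i(q;q)_j(q^2;q^2)_k}=\frac{(q^4,q^{16},q^{20};q^{20})_\infty}{(q;q)_\infty}.$$ Example 10: $$\sum_{i,j,k\ge 0}\frac{q^{i^2+2j^2+2k^2+ij+2ik+2jk+k}}{(q;q)_i(q;q)_j(q^2;q^2)_k}=\frac{(q^4,q^6,q^{10};q^{10})_\infty}{(q;q)_\infty},$$ $$\sum_{i,j,k\ge 0}\frac{q^{i^2+2j^2+2k^2+ij+2ik+2jk+2j+k}}{(q;q)_i(q;q)_j(q^2;q^2)_k}=\frac{(q^2,q^8,q^{10};q^{10})_\infty}{(q;q)_\infty}.$$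 Moreover, for $d=(1,1,2)$, $D=\mathrm{diag}(1,1,2)$ and each of the eight pairs $(A,b)$ $$A=\begin{pmatrix}1&1&0\\1&2&1\\0&2&4\end{pmatrix},\ b\in\{(\tfrac12,1,0)^{\mathrm T},(\tfrac12,1,4)^{\mathrm T}\};\qquad A=\begin{pmatrix}1&1&1\\1&5&4\\2&8&8\end{pmatrix},\ b\in\{(\tfrac12,-\tfrac12,0)^{\mathrm T},(\tfrac12,\tfrac32,4)^{\mathrm T}\};$$ $$A=\begin{pmatrix}1&1&0\\1&8&1\\0&2&1\end{pmatrix},\ b\in\{(\tfrac12,0,1)^{\mathrm T},(\tfrac12,4,1)^{\mathrm T}\};\qquad A=\begin{pmatrix}2&1&1\\1&4&1\\2&2&2\end{pmatrix},\ b\in\{(0,0,1)^{\mathrm T},(0,2,1)^{\mathrm T}\},$$ the matrix $AD$ is symmetric positive definite and there is $c\in\mathbb Q$ such that the generalized Nahm sum $$\widetilde f_{A,b,c,d}(q)=\sum_{n\in\mathbb Z_{\ge 0}^3}\frac{q^{\frac12 n^{\mathrm T}ADn+n^{\mathrm T}b+c}}{(q;q)_{n_1}(q;q)_{n_2}(q^2;q^2)_{n_3}},\qquad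 q^s=e^{2\pi i s\tau}\ (s\in\mathbb Q),$$ is a modular function of $\tau$: it is holomorphic on the upper half plane, invariant under some subgroup of finite index in $\mathrm{SL}_2(\mathbb Z)$, and has at most a pole at every cusp. -/

import Mathlib

open scoped UpperHalfPlane Manifold MatrixGroups

noncomputable section

/-- The finite `q`-Pochhammer symbol `(a; q)_n = ∏_{k < n} (1 - a q^k)`. -/
def qPoch (a q : ℂ) (n : ℕ) : ℂ := ∏ k ∈ Finset.range n, (1 - a * q ^ k)

/-- The infinite `q`-Pochhammer symbol `(a; q)_∞ = ∏_{k ≥ 0} (1 - a q^k)`;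
the product converges absolutely when `‖q‖ < 1`. -/
def qPochInf (a q : ℂ) : ℂ := ∏' k : ℕ, (1 - a * q ^ k)

/-- The compressed symbol `(a₁, a₂, a₃; q)_∞ = (a₁; q)_∞ (a₂; q)_∞ (a₃; q)_∞`. -/
def qPochInf₃ (a₁ a₂ a₃ q : ℂ) : ℂ := qPochInf a₁ q * qPochInf a₂ q * qPochInf a₃ q

/-- The exponent `½ nᵀ A D n + nᵀ b + c` of a generalized Nahm sum, where `D = diag(d₁, …, d_r)`. -/
def nahmExponent {r : ℕ} (A : Matrix (Fin r) (Fin r) ℚ) (b : Fin r → ℚ) (c : ℚ) (d : Fin r → ℕ)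
    (n : Fin r → ℕ) : ℚ :=
  1 / 2 * ((fun i => (n i : ℚ)) ⬝ᵥ
      Matrix.mulVec (A * Matrix.diagonal (fun i => (d i : ℚ))) (fun i => (n i : ℚ)))
    + (fun i => (n i : ℚ)) ⬝ᵥ b + c

/-- The generalized Nahm sum
`∑_{n ∈ ℕ^r} q^{½ nᵀ A D n + nᵀ b + c} / ((q^{d₁}; q^{d₁})_{n₁} ⋯ (q^{d_r}; q^{d_r})_{n_r})`
as a function of `τ` in the upper half plane, where `q^s = exp(2πi s τ)` for rational `s`. -/
def nahmSum {r : ℕ} (A : Matrix (Fin r) (Fin r) ℚ) (b : Fin r → ℚ) (c : ℚ) (d : Fin r → ℕ)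
    (τ : ℍ) : ℂ :=
  ∑' n : Fin r → ℕ,
    Complex.exp (2 * Real.pi * Complex.I * (nahmExponent A b c d n : ℂ) * (τ : ℂ)) /
      ∏ i, qPoch (Complex.exp (2 * Real.pi * Complex.I * (d i : ℂ) * (τ : ℂ)))
        (Complex.exp (2 * Real.pi * Complex.I * (d i : ℂ) * (τ : ℂ))) (n i)

/-- A modular function (of weight `0`) for some subgroup of finite index in `SL(2, ℤ)`:
holomorphic on the upper half plane, invariant under the subgroup, and with at most a pole at
every cusp. -/
def IsModularFunction (f : ℍ → ℂ) : Prop :=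
  MDifferentiable 𝓘(ℂ) 𝓘(ℂ) f ∧
  (∃ Γ : Subgroup SL(2, ℤ), Γ.FiniteIndex ∧ ∀ γ ∈ Γ, ∀ τ : ℍ, f (γ • τ) = f τ) ∧
  ∀ γ : SL(2, ℤ), ∃ m : ℕ, UpperHalfPlane.IsBoundedAtImInfty
    (fun τ : ℍ => Complex.exp (2 * Real.pi * Complex.I * (m : ℂ) * (τ : ℂ)) * f (γ • τ))

/-- `(A, b, c, d)` is a modular quadruple: the `d i` are positive, `A D` is symmetric positive
definite, and the associated generalized Nahm sum is a modular function. -/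
def IsModularQuadruple {r : ℕ} (A : Matrix (Fin r) (Fin r) ℚ) (b : Fin r → ℚ) (c : ℚ)
    (d : Fin r → ℕ) : Prop :=
  (∀ i, 0 < d i) ∧
  ((A * Matrix.diagonal (fun i => (d i : ℚ))).map (fun x : ℚ => (x : ℝ))).PosDef ∧
  IsModularFunction (nahmSum A b c d)

/-- The identity of index `(1, 1, 2)`
`∑_{i,j,k ≥ 0} q^{E(i,j,k)} / ((q; q)_i (q; q)_j (q²; q²)_k) = P`, with absolute convergence of the
triple sum. It is only used for exponents `E` that take values in the nonnegative integers, for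
which the complex power is the ordinary power. -/
def HasIndex112Sum (q : ℂ) (E : ℂ → ℂ → ℂ → ℂ) (P : ℂ) : Prop :=
  HasSum (fun n : ℕ × ℕ × ℕ =>
    q ^ (E n.1 n.2.1 n.2.2) / (qPoch q q n.1 * qPoch q q n.2.1 * qPoch (q ^ 2) (q ^ 2) n.2.2)) P

end

/-!
Either Euler's identity, applied to the sum over `i`, or the expansion of `1 / (q; q)_n` as a finite
sum over `j + 2k = n` reduces each triple sum to the double sum of `q^{i(i+1)/2 + ij + 2j² + 2ej}`
over `(q; q)_i (q; q)_j`, in the variable `q²` or `q`. A further application of Euler's identity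
turns the double sum into a Rogers–Ramanujan sum, which Bailey's lemma and the Jacobi triple product
evaluate.

For modularity, the triple product writes each right-hand side, up to a power of `q`, as the
quotient by `η(τ)` of `θ(Nτ)` for a theta function `θ` with rational characteristics. A suitable
power of this quotient has only finitely many conjugates under `SL(2, ℤ)`, because translation and
inversion permute the powers of the theta functions with a given denominator. Since a continuous
root of a function without zeros is determined by its value at one point, the quotient itself has
finitely many conjugates.
-/

noncomputable section

open Filter Topology

/-! ### `q`-Pochhammer symbols -/

@[simp] lemma qPoch_zero (a q : ℂ) : qPoch a q 0 = 1 := by simp [qPoch]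

lemma qPoch_succ (a q : ℂ) (n : ℕ) : qPoch a q (n + 1) = qPoch a q n * (1 - a * q ^ n) := by
  simp [qPoch, Finset.prod_range_succ]

lemma qPoch_add (a q : ℂ) (m n : ℕ) :
    qPoch a q (m + n) = qPoch a q m * qPoch (a * q ^ m) q n := by
  simp only [qPoch, Finset.prod_range_add, pow_add, mul_assoc]

lemma qPoch_mul_qPoch_neg (q : ℂ) (n : ℕ) :
    qPoch q q n * qPoch (-q) q n = qPoch (q ^ 2) (q ^ 2) n := by
  simp only [qPoch, ← Finset.prod_mul_distrib]
  exact Finset.prod_congr rfl fun k _ => by ring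

section NotRootOfUnity

variable {q : ℂ}

lemma pow_succ_ne_one (hq : ‖q‖ < 1) (n : ℕ) : q ^ (n + 1) ≠ 1 := fun h => by
  have h_lt : ‖q ^ (n + 1)‖ < 1 := by
    rw [norm_pow]
    exact pow_lt_one₀ (norm_nonneg q) hq n.succ_ne_zero
  rw [h, norm_one] at h_lt
  exact h_lt.false

lemma inv_qPoch_self (hq : ∀ n, q ^ (n + 1) ≠ 1) (n : ℕ) :
    (qPoch q q n)⁻¹ = (1 - q ^ (n + 1)) * (qPoch q q (n + 1))⁻¹ := by
  have h_factor : 1 - q ^ (n + 1) ≠ 0 := sub_ne_zero.2 (hq n).symm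
  rw [qPoch_succ, ← pow_succ', mul_inv, mul_comm, mul_assoc, inv_mul_cancel₀ h_factor, mul_one]

end NotRootOfUnity

section NormLtOne

variable {a q : ℂ}

lemma norm_mul_lt_one {x y : ℂ} (hx : ‖x‖ < 1) (hy : ‖y‖ < 1) : ‖x * y‖ < 1 := by
  rw [norm_mul]
  exact mul_lt_one_of_nonneg_of_lt_one_left (norm_nonneg x) hx hy.le

lemma norm_pow_lt_one (hq : ‖q‖ < 1) {n : ℕ} (hn : n ≠ 0) : ‖q ^ n‖ < 1 := by
  rw [norm_pow]
  exact pow_lt_one₀ (norm_nonneg q) hq hn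

lemma norm_pow_le_norm_pow (hq : ‖q‖ < 1) {m n : ℕ} (h : m ≤ n) : ‖q ^ n‖ ≤ ‖q‖ ^ m := by
  rw [norm_pow]
  exact pow_le_pow_of_le_one (norm_nonneg q) hq.le h

lemma norm_mul_pow_le (a : ℂ) (hq : ‖q‖ < 1) (n : ℕ) : ‖a * q ^ n‖ ≤ ‖a‖ := by
  rw [norm_mul]
  exact mul_le_of_le_one_right (norm_nonneg a) (norm_pow_le_norm_pow hq n.zero_le)

lemma one_sub_mul_pow_ne_zero (ha : ‖a‖ < 1) (hq : ‖q‖ < 1) (n : ℕ) : 1 - a * q ^ n ≠ 0 :=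
  fun h => by
    have h_lt := (norm_mul_pow_le a hq n).trans_lt ha
    rw [← sub_eq_zero.1 h, norm_one] at h_lt
    exact h_lt.false

lemma qPoch_ne_zero (ha : ‖a‖ < 1) (hq : ‖q‖ < 1) (n : ℕ) : qPoch a q n ≠ 0 :=
  Finset.prod_ne_zero_iff.2 fun k _ => one_sub_mul_pow_ne_zero ha hq k

lemma summable_norm_neg_mul_pow (a : ℂ) (hq : ‖q‖ < 1) :
    Summable fun k : ℕ => ‖-(a * q ^ k)‖ := by
  simp only [norm_neg, norm_mul, norm_pow]
  exact (summable_geometric_of_lt_one (norm_nonneg q) hq).mul_left _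

lemma tendsto_qPoch (a : ℂ) (hq : ‖q‖ < 1) :
    Tendsto (qPoch a q) atTop (𝓝 (qPochInf a q)) := by
  have h := multipliable_one_add_of_summable (summable_norm_neg_mul_pow a hq)
  simp only [← sub_eq_add_neg] at h
  exact h.tendsto_prod_tprod_nat

lemma qPochInf_ne_zero (ha : ‖a‖ < 1) (hq : ‖q‖ < 1) : qPochInf a q ≠ 0 := by
  have h := tprod_one_add_ne_zero_of_summable (f := fun k : ℕ => -(a * q ^ k))
    (fun k => by simpa only [← sub_eq_add_neg] using one_sub_mul_pow_ne_zero ha hq k)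
    (summable_norm_neg_mul_pow a hq)
  simpa only [qPochInf, sub_eq_add_neg] using h

lemma qPoch_mul_qPochInf (a : ℂ) (hq : ‖q‖ < 1) (n : ℕ) :
    qPoch a q n * qPochInf (a * q ^ n) q = qPochInf a q := by
  refine tendsto_nhds_unique ((tendsto_qPoch (a * q ^ n) hq).const_mul (qPoch a q n)) ?_
  simp only [← qPoch_add, add_comm n]
  exact (tendsto_add_atTop_iff_nat n).2 (tendsto_qPoch a hq)

lemma qPochInf_mul_qPochInf_neg (hq : ‖q‖ < 1) :
    qPochInf q q * qPochInf (-q) q = qPochInf (q ^ 2) (q ^ 2) :=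
  tendsto_nhds_unique
    (((tendsto_qPoch q hq).mul (tendsto_qPoch (-q) hq)).congr (qPoch_mul_qPoch_neg q))
    (tendsto_qPoch _ (norm_pow_lt_one hq two_ne_zero))

lemma tendsto_inv_qPoch_self (hq : ‖q‖ < 1) :
    Tendsto (fun n => (qPoch q q n)⁻¹) atTop (𝓝 (qPochInf q q)⁻¹) :=
  (tendsto_qPoch q hq).inv₀ (qPochInf_ne_zero hq hq)

lemma exists_norm_inv_qPoch_self_le (hq : ‖q‖ < 1) :
    ∃ C : ℝ, 0 ≤ C ∧ ∀ n, ‖(qPoch q q n)⁻¹‖ ≤ C := by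
  obtain ⟨C, hC⟩ :=
    (Metric.isBounded_range_of_tendsto _ (tendsto_inv_qPoch_self hq)).exists_norm_le
  exact ⟨C, (norm_nonneg _).trans (hC _ ⟨0, rfl⟩), fun n => hC _ ⟨n, rfl⟩⟩

end NormLtOne

/-! ### Rearranging double series -/

lemma hasSum_of_hasSum_fiberwise {β γ : Type*} {f : β × γ → ℂ} {g : β → ℂ} {a : ℂ}
    (hf : Summable f) (h_fiber : ∀ b, HasSum (fun c => f (b, c)) (g b)) (hg : HasSum g a) :
    HasSum f a := by
  rw [hg.unique (hf.hasSum.prod_fiberwise h_fiber)]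
  exact hf.hasSum

lemma hasSum_sum_antidiagonal {f : ℕ × ℕ → ℂ} {a : ℂ} (h : HasSum f a) :
    HasSum (fun n => ∑ p ∈ Finset.HasAntidiagonal.antidiagonal n, f p) a := by
  refine (Finset.HasAntidiagonal.sigmaAntidiagonalEquivProd.hasSum_iff.2 h).sigma fun n => ?_
  rw [← Finset.sum_coe_sort]
  exact hasSum_fintype _

lemma tendsto_tsum_of_tendsto_zero {f : ℕ → ℕ → ℂ} {bound : ℕ → ℝ} {c : ℂ}
    (h_bound : Summable bound) (h_le : ∀ a n, ‖f a n‖ ≤ bound n)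
    (h_zero : Tendsto (fun a => f a 0) atTop (𝓝 c))
    (h_succ : ∀ n, Tendsto (fun a => f a (n + 1)) atTop (𝓝 0)) :
    Tendsto (fun a => ∑' n, f a n) atTop (𝓝 c) := by
  rw [← tsum_ite_eq 0 fun _ => c]
  refine tendsto_tsum_of_dominated_convergence h_bound (fun n => ?_)
    (Eventually.of_forall fun a n => h_le a n)
  cases n with
  | zero => exact h_zero
  | succ n => exact h_succ n

/-! ### Euler's identity -/

section Euler

variable {q x : ℂ}

lemma choose_two_succ (n : ℕ) : (n + 1).choose 2 = n.choose 2 + n := by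
  rw [Nat.choose_succ_succ' n 1, Nat.choose_one_right, add_comm]

lemma exists_norm_eulerTerm_le (hq : ‖q‖ < 1) :
    ∃ C : ℝ, ∀ (x : ℂ) (i : ℕ), ‖q ^ i.choose 2 * x ^ i / qPoch q q i‖ ≤ ‖x‖ ^ i * C := by
  obtain ⟨C, -, hC⟩ := exists_norm_inv_qPoch_self_le hq
  refine ⟨C, fun x i => ?_⟩
  rw [div_eq_mul_inv, norm_mul, norm_mul, norm_pow x]
  have h_pow := norm_pow_le_norm_pow hq (i.choose 2).zero_le
  gcongr
  · exact mul_le_of_le_one_left (by positivity) h_pow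
  · exact hC i

lemma summable_euler (hq : ‖q‖ < 1) (hx : ‖x‖ < 1) :
    Summable fun i : ℕ => q ^ i.choose 2 * x ^ i / qPoch q q i := by
  obtain ⟨C, hC⟩ := exists_norm_eulerTerm_le hq
  exact .of_norm_bounded ((summable_geometric_of_lt_one (norm_nonneg x) hx).mul_right C) (hC x)

lemma tsum_euler_eq_one_add_mul (hq : ‖q‖ < 1) (hx : ‖x‖ < 1) :
    ∑' i : ℕ, q ^ i.choose 2 * x ^ i / qPoch q q i =
      (1 + x) * ∑' i : ℕ, q ^ i.choose 2 * (x * q) ^ i / qPoch q q i := by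
  have s₁ := summable_euler hq hx
  have s₂ := summable_euler hq (norm_mul_lt_one hx hq)
  have h_diff : ∑' i : ℕ, (q ^ i.choose 2 * x ^ i / qPoch q q i -
      q ^ i.choose 2 * (x * q) ^ i / qPoch q q i) =
      x * ∑' i : ℕ, q ^ i.choose 2 * (x * q) ^ i / qPoch q q i := by
    rw [(s₁.sub s₂).tsum_eq_zero_add, ← tsum_mul_left]
    simp only [Nat.choose_zero_succ, pow_zero, qPoch_zero, sub_self, zero_add]
    refine tsum_congr fun i => ?_
    rw [choose_two_succ, div_eq_mul_inv _ (qPoch q q i), inv_qPoch_self (pow_succ_ne_one hq)]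
    ring
  rw [s₁.tsum_sub s₂] at h_diff
  linear_combination h_diff

theorem hasSum_euler (hq : ‖q‖ < 1) (hx : ‖x‖ < 1) :
    HasSum (fun i : ℕ => q ^ i.choose 2 * x ^ i / qPoch q q i) (qPochInf (-x) q) := by
  set L : ℂ → ℂ := fun y => ∑' i : ℕ, q ^ i.choose 2 * y ^ i / qPoch q q i
  have h_iterate : ∀ n : ℕ, L x = qPoch (-x) q n * L (x * q ^ n) := fun n => by
    induction n with
    | zero => simp
    | succ n ih =>
      have h_step : L (x * q ^ n) = (1 + x * q ^ n) * L (x * q ^ n * q) :=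
        tsum_euler_eq_one_add_mul hq ((norm_mul_pow_le x hq n).trans_lt hx)
      rw [ih, h_step, qPoch_succ, pow_succ, mul_assoc x]
      ring
  have h_lim : Tendsto (fun n : ℕ => L (x * q ^ n)) atTop (𝓝 1) := by
    obtain ⟨C, hC⟩ := exists_norm_eulerTerm_le hq
    have hC_nonneg : 0 ≤ C := zero_le_one.trans (by simpa using hC x 0)
    refine tendsto_tsum_of_tendsto_zero
      ((summable_geometric_of_lt_one (norm_nonneg x) hx).mul_right C)
      (fun n i => (hC _ i).trans ?_) (by simp) fun i => ?_
    · gcongr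
      exact norm_mul_pow_le x hq n
    · have h_zero : Tendsto (fun n : ℕ => x * q ^ n) atTop (𝓝 0) := by
        simpa using (tendsto_pow_atTop_nhds_zero_of_norm_lt_one hq).const_mul x
      simpa using ((h_zero.pow (i + 1)).const_mul (q ^ (i + 1).choose 2)).div_const
        (qPoch q q (i + 1))
  have h_eq : qPochInf (-x) q = L x := by
    simpa using tendsto_nhds_unique
      (((tendsto_qPoch (-x) hq).mul h_lim).congr fun n => (h_iterate n).symm) tendsto_const_nhds
  rw [h_eq]
  exact (summable_euler hq hx).hasSum

end Euler

/-! ### Cauchy's identity -/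

/-- The series `∑ q^{t² + e t} / ((q; q)_t (q; q)_{t + a})`. For `e = a` it counts partitions by
their Durfee rectangle of size `t × (t + a)`; general `e` occurs in the recurrences between the
different `a`. -/
def cauchySeries (q : ℂ) (a e : ℕ) : ℂ :=
  ∑' t : ℕ, q ^ (t ^ 2 + e * t) / (qPoch q q t * qPoch q q (t + a))

section Cauchy

variable {q : ℂ}

lemma exists_norm_cauchyTerm_le (hq : ‖q‖ < 1) :
    ∃ C : ℝ, ∀ a e t : ℕ,
      ‖q ^ (t ^ 2 + e * t) / (qPoch q q t * qPoch q q (t + a))‖ ≤ ‖q‖ ^ t * C := by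
  obtain ⟨C, hC_nonneg, hC⟩ := exists_norm_inv_qPoch_self_le hq
  refine ⟨C * C, fun a e t => ?_⟩
  have h_le : t ≤ t ^ 2 + e * t := le_add_right (Nat.le_self_pow two_ne_zero t)
  rw [div_eq_mul_inv, mul_inv, norm_mul, norm_mul]
  gcongr
  · exact norm_pow_le_norm_pow hq h_le
  · exact hC t
  · exact hC _

lemma summable_cauchy (hq : ‖q‖ < 1) (a e : ℕ) :
    Summable fun t : ℕ => q ^ (t ^ 2 + e * t) / (qPoch q q t * qPoch q q (t + a)) := by
  obtain ⟨C, hC⟩ := exists_norm_cauchyTerm_le hq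
  exact .of_norm_bounded ((summable_geometric_of_lt_one (norm_nonneg q) hq).mul_right C) (hC a e)

lemma cauchySeries_eq_sub (hq : ‖q‖ < 1) (a e : ℕ) :
    cauchySeries q a e =
      cauchySeries q (a + 1) e - q ^ (a + 1) * cauchySeries q (a + 1) (e + 1) := by
  rw [cauchySeries, cauchySeries, cauchySeries, ← tsum_mul_left,
    ← (summable_cauchy hq _ _).tsum_sub ((summable_cauchy hq _ _).mul_left _)]
  refine tsum_congr fun t => ?_
  rw [← add_assoc, div_eq_mul_inv, mul_inv, inv_qPoch_self (pow_succ_ne_one hq) (t + a)]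
  ring

lemma cauchySeries_sub_eq_mul (hq : ‖q‖ < 1) (a e : ℕ) :
    cauchySeries q a e - cauchySeries q a (e + 1) =
      q ^ (e + 1) * cauchySeries q (a + 1) (e + 2) := by
  rw [cauchySeries, cauchySeries, cauchySeries, ← tsum_mul_left,
    ← (summable_cauchy hq _ _).tsum_sub (summable_cauchy hq _ _),
    ((summable_cauchy hq _ _).sub (summable_cauchy hq _ _)).tsum_eq_zero_add]
  simp only [ne_eq, OfNat.ofNat_ne_zero, not_false_eq_true, zero_pow, mul_zero, add_zero, pow_zero,
    sub_self, zero_add]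
  refine tsum_congr fun t => ?_
  rw [add_right_comm t 1 a, ← add_assoc, div_eq_mul_inv _ (qPoch q q t * _), mul_inv,
    inv_qPoch_self (pow_succ_ne_one hq) t]
  ring

lemma tendsto_cauchySeries_diag (hq : ‖q‖ < 1) :
    Tendsto (fun a => cauchySeries q a a) atTop (𝓝 (qPochInf q q)⁻¹) := by
  obtain ⟨C, hC⟩ := exists_norm_cauchyTerm_le hq
  refine tendsto_tsum_of_tendsto_zero
    ((summable_geometric_of_lt_one (norm_nonneg q) hq).mul_right C) (fun a t => hC a a t)
    (by simpa using tendsto_inv_qPoch_self hq) fun t => ?_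
  have h_pow : Tendsto (fun a : ℕ => (q ^ (t + 1)) ^ a) atTop (𝓝 0) :=
    tendsto_pow_atTop_nhds_zero_of_norm_lt_one (norm_pow_lt_one hq t.succ_ne_zero)
  have h_inv := (tendsto_add_atTop_iff_nat (t + 1)).2 (tendsto_inv_qPoch_self hq)
  have h_prod := ((h_pow.const_mul (q ^ (t + 1) ^ 2)).mul h_inv).mul_const (qPoch q q (t + 1))⁻¹
  simp only [mul_zero, zero_mul] at h_prod
  refine h_prod.congr fun a => ?_
  rw [add_comm (t + 1) a, div_eq_mul_inv, mul_inv, ← pow_mul, pow_add q ((t + 1) ^ 2), mul_comm a]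
  ring

theorem cauchySeries_diag (hq : ‖q‖ < 1) (a : ℕ) : cauchySeries q a a = (qPochInf q q)⁻¹ := by
  set Δ : ℕ → ℂ := fun a => cauchySeries q a a - cauchySeries q (a + 1) (a + 1)
  have h_rec : ∀ a, Δ a = -q ^ (a + 1) * Δ (a + 1) := fun a => by
    linear_combination cauchySeries_eq_sub hq a a + cauchySeries_sub_eq_mul hq (a + 1) a
  have h_mono : Monotone fun a => ‖Δ a‖ := monotone_nat_of_le_succ fun a => by
    rw [h_rec, norm_mul, norm_neg]
    exact mul_le_of_le_one_left (norm_nonneg _) (norm_pow_le_norm_pow hq (a + 1).zero_le)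
  have h_lim := tendsto_cauchySeries_diag hq
  have h_lim_Δ : Tendsto (fun a => ‖Δ a‖) atTop (𝓝 0) := by
    simpa using (h_lim.sub ((tendsto_add_atTop_iff_nat 1).2 h_lim)).norm
  have h_step : ∀ a, cauchySeries q (a + 1) (a + 1) = cauchySeries q a a := fun a =>
    (sub_eq_zero.1 (norm_le_zero_iff.1 (h_mono.ge_of_tendsto h_lim_Δ a))).symm
  have h_const : ∀ b, cauchySeries q (a + b) (a + b) = cauchySeries q a a := fun b => by
    induction b with
    | zero => rfl
    | succ b ih => rw [← add_assoc, h_step, ih]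
  have h_lim_shift : Tendsto (fun b => cauchySeries q (a + b) (a + b)) atTop
      (𝓝 (qPochInf q q)⁻¹) := by
    simpa only [add_comm a] using (tendsto_add_atTop_iff_nat a).2 h_lim
  exact tendsto_nhds_unique (tendsto_const_nhds.congr fun b => (h_const b).symm) h_lim_shift

theorem hasSum_cauchy (hq : ‖q‖ < 1) (a : ℕ) :
    HasSum (fun t : ℕ => q ^ (t ^ 2 + a * t) / (qPoch q q t * qPoch q q (t + a)))
      (qPochInf q q)⁻¹ := by
  rw [← cauchySeries_diag hq a]
  exact (summable_cauchy hq a a).hasSum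

end Cauchy

/-! ### The Jacobi triple product -/

/-- The exponent `n(n+1)/2` in the theta series of Jacobi's triple product, as a natural number;
the truncation `toNat` is harmless because `n(n+1) ≥ 0` for every integer `n`. -/
def triangle (n : ℤ) : ℕ := (n * (n + 1) / 2).toNat

lemma triangle_mul_two (n : ℤ) : (triangle n : ℤ) * 2 = n * (n + 1) := by
  have h_nonneg : 0 ≤ n * (n + 1) := by
    rcases lt_or_ge n 0 with hn | hn
    · exact mul_nonneg_of_nonpos_of_nonpos hn.le (by omega)
    · positivity
  rw [triangle, Int.toNat_of_nonneg (Int.ediv_nonneg h_nonneg two_pos.le),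
    Int.ediv_mul_cancel (Int.even_mul_succ_self n).two_dvd]

lemma choose_two_mul_two (n : ℕ) : (n.choose 2 : ℤ) * 2 = n * (n - 1) := by
  induction n with
  | zero => simp
  | succ n ih =>
    rw [choose_two_succ]
    push_cast
    linear_combination ih

lemma triangle_natCast (n : ℕ) : triangle n = n.choose 2 + n := by
  have h := triangle_mul_two n
  have h' := choose_two_mul_two n
  zify
  linarith

lemma triangle_neg_natCast (n : ℕ) : triangle (-n) = n.choose 2 := by
  have h := triangle_mul_two (-n)
  have h' := choose_two_mul_two n
  zify
  linarith

/-- The terms of Ramanujan's two-variable theta series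
`f(-x, -y) = ∑ (-1)^n x^{n(n+1)/2} y^{n(n-1)/2}`. -/
def jacobiTerm (x y : ℂ) (n : ℤ) : ℂ := (-1) ^ n.natAbs * x ^ triangle n * y ^ triangle (-n)

lemma jacobiTerm_natCast (x y : ℂ) (n : ℕ) :
    jacobiTerm x y n = (-1) ^ n * ((x * y) ^ n.choose 2 * x ^ n) := by
  rw [jacobiTerm, triangle_natCast, triangle_neg_natCast, Int.natAbs_natCast]
  ring

lemma jacobiTerm_neg (x y : ℂ) (n : ℤ) : jacobiTerm x y (-n) = jacobiTerm y x n := by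
  rw [jacobiTerm, jacobiTerm, neg_neg, Int.natAbs_neg, mul_right_comm]

/-- Pairs of natural numbers, indexed by the difference and the minimum of the entries. -/
def intProdNatEquiv : ℤ × ℕ ≃ ℕ × ℕ where
  toFun p := (p.2 + p.1.toNat, p.2 + (-p.1).toNat)
  invFun p := (p.1 - p.2, min p.1 p.2)
  left_inv := by
    rintro ⟨n, t⟩
    ext <;> dsimp only <;> omega
  right_inv := by
    rintro ⟨i, j⟩
    ext <;> dsimp only <;> omega

lemma choose_two_add_add (a t : ℕ) :
    (t + a).choose 2 + t.choose 2 + t = a.choose 2 + (t ^ 2 + a * t) := by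
  have h_add := choose_two_mul_two (t + a)
  have h_t := choose_two_mul_two t
  have h_a := choose_two_mul_two a
  push_cast at h_add
  zify
  linarith

lemma euler_mul_euler_eq_jacobiTerm_mul (x y : ℂ) (a t : ℕ) :
    (x * y) ^ (t + a).choose 2 * (-x) ^ (t + a) / qPoch (x * y) (x * y) (t + a) *
        ((x * y) ^ t.choose 2 * (-y) ^ t / qPoch (x * y) (x * y) t) =
      jacobiTerm x y a * ((x * y) ^ (t ^ 2 + a * t) /
        (qPoch (x * y) (x * y) t * qPoch (x * y) (x * y) (t + a))) := by
  have h_exponent : (x * y) ^ (t + a).choose 2 * (x * y) ^ t.choose 2 * (x * y) ^ t =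
      (x * y) ^ a.choose 2 * (x * y) ^ (t ^ 2 + a * t) := by
    rw [← pow_add, ← pow_add, ← pow_add, choose_two_add_add]
  have h_sign : (-x) ^ (t + a) * (-y) ^ t = (-1) ^ a * x ^ a * (x * y) ^ t := by
    rw [add_comm t, pow_add, mul_assoc, ← mul_pow, neg_mul_neg, neg_pow x]
  rw [jacobiTerm_natCast, div_mul_div_comm, ← mul_div_assoc, mul_comm (qPoch _ _ t)]
  congr 1
  linear_combination (x * y) ^ (t + a).choose 2 * (x * y) ^ t.choose 2 * h_sign +
    (-1) ^ a * x ^ a * h_exponent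

/-- Jacobi's triple product. Multiplying the two Euler series for `(x; xy)_∞` and `(y; xy)_∞` and
collecting the terms `(i, j)` with `i - j = n`, Cauchy's identity sums each diagonal. -/
theorem hasSum_jacobiTerm {x y : ℂ} (hx : ‖x‖ < 1) (hy : ‖y‖ < 1) :
    HasSum (jacobiTerm x y) (qPochInf₃ x y (x * y) (x * y)) := by
  have hq : ‖x * y‖ < 1 := norm_mul_lt_one hx hy
  have h_euler_x := hasSum_euler hq ((norm_neg x).trans_lt hx)
  have h_euler_y := hasSum_euler hq ((norm_neg y).trans_lt hy)
  rw [neg_neg] at h_euler_x h_euler_y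
  have h_summable := summable_mul_of_summable_norm h_euler_x.summable.norm h_euler_y.summable.norm
  have h_mul := h_euler_x.mul h_euler_y h_summable
  have h_diag : HasSum (fun n => jacobiTerm x y n * (qPochInf (x * y) (x * y))⁻¹)
      (qPochInf x (x * y) * qPochInf y (x * y)) := by
    have h_reindexed := intProdNatEquiv.hasSum_iff.2 h_mul
    refine h_reindexed.prod_fiberwise fun n => ?_
    refine ((hasSum_cauchy hq n.natAbs).mul_left (jacobiTerm x y n)).congr_fun fun t => ?_
    obtain ⟨a, rfl | rfl⟩ := n.eq_nat_or_neg
    · simpa [intProdNatEquiv] using euler_mul_euler_eq_jacobiTerm_mul x y a t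
    · rw [jacobiTerm_neg]
      simpa [intProdNatEquiv, mul_comm] using euler_mul_euler_eq_jacobiTerm_mul y x a t
  have h_scaled := h_diag.mul_right (qPochInf (x * y) (x * y))
  simpa only [qPochInf₃, mul_assoc, inv_mul_cancel₀ (qPochInf_ne_zero hq hq), mul_one]
    using h_scaled

/-! ### Bailey pairs and the Rogers–Ramanujan identities -/

/-- The matrix entries `1 / ((q; q)_{n-m} (q; q)_{n+m+e})` of the Bailey transform; they are meant
for `m ≤ n` only, since the subtraction is truncated. -/
def baileyEntry (q : ℂ) (e n m : ℕ) : ℂ := (qPoch q q (n - m))⁻¹ * (qPoch q q (n + m + e))⁻¹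

/-- `(α, β)` is a Bailey pair relative to `q ^ e`. The normalization
`β n = ∑ α m / ((q; q)_{n-m} (q; q)_{n+m+e})` differs by the constant factor `(q; q)_e` from the
usual one, which has `(q^{e+1}; q)_{n+m}` in the denominator. -/
def IsBaileyPair (q : ℂ) (e : ℕ) (α β : ℕ → ℂ) : Prop :=
  ∀ n, ∑ m ∈ Finset.range (n + 1), α m * baileyEntry q e n m = β n

/-- The sequence `α` of the Bailey pair B(1) in Slater's list, with `β n = 1 / (q; q)_n`. -/
def slaterB1 (q : ℂ) (m : ℕ) : ℂ :=
  if m = 0 then 1 else (-1) ^ m * q ^ (m + 3 * m.choose 2) * (1 + q ^ m)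

/-- The sequence `α` of the Bailey pair B(3) in Slater's list, with `β n = 1 / (q; q)_n`. -/
def slaterB3 (q : ℂ) (m : ℕ) : ℂ :=
  (-1) ^ m * q ^ (2 * m + 3 * m.choose 2) * (1 - q ^ (2 * m + 1))

section FiniteIdentities

variable {q : ℂ}

lemma baileyEntry_add (q : ℂ) (e m t : ℕ) :
    baileyEntry q e (m + t) m = (qPoch q q t)⁻¹ * (qPoch q q (t + (2 * m + e)))⁻¹ := by
  rw [baileyEntry, Nat.add_sub_cancel_left, show m + t + m + e = t + (2 * m + e) by omega]

lemma baileyEntry_self (q : ℂ) (e m : ℕ) :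
    baileyEntry q e m m = (qPoch q q (2 * m + e))⁻¹ := by
  simpa using baileyEntry_add q e m 0

lemma sum_slaterB1_telescope (hq : ∀ n, q ^ (n + 1) ≠ 1) (n M : ℕ) (hM : M ≤ n) :
    ∑ m ∈ Finset.range (M + 1), slaterB1 q m *
      ((1 - q ^ (n + 1)) * baileyEntry q 0 (n + 1) m - baileyEntry q 0 n m) =
    (-1) ^ M * q ^ (n + 1 + 3 * (M + 1).choose 2) * baileyEntry q 1 n M := by
  induction M with
  | zero =>
    simp only [zero_add, Finset.range_one, Finset.sum_singleton, slaterB1, if_true, baileyEntry,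
      tsub_zero, add_zero, pow_zero]
    rw [inv_qPoch_self hq n, Nat.choose_eq_zero_of_lt one_lt_two]
    ring
  | succ M ih =>
    obtain ⟨t, rfl⟩ := Nat.exists_eq_add_of_le hM
    have h_prev : baileyEntry q 1 (M + 1 + t) M =
        (qPoch q q (t + 1))⁻¹ * (qPoch q q (t + (2 * (M + 1))))⁻¹ := by
      rw [add_assoc M 1 t, baileyEntry_add]
      congr 3 <;> omega
    rw [Finset.sum_range_succ, ih (by omega), h_prev, add_assoc (M + 1) t 1, baileyEntry_add,
      baileyEntry_add, baileyEntry_add, add_zero, inv_qPoch_self hq t, add_right_comm t 1,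
      ← add_assoc t (2 * (M + 1)) 1, inv_qPoch_self hq (t + 2 * (M + 1)),
      choose_two_succ (M + 1), slaterB1, if_neg M.succ_ne_zero]
    ring

theorem isBaileyPair_slaterB1 (hq : ∀ n, q ^ (n + 1) ≠ 1) :
    IsBaileyPair q 0 (slaterB1 q) fun n => (qPoch q q n)⁻¹ := by
  intro n
  induction n with
  | zero => simp [slaterB1, baileyEntry]
  | succ n ih =>
    have h_factor : 1 - q ^ (n + 1) ≠ 0 := sub_ne_zero.2 (hq n).symm
    have h_telescope := sum_slaterB1_telescope hq n n le_rfl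
    simp only [mul_sub, Finset.sum_sub_distrib, mul_left_comm _ (1 - q ^ (n + 1)),
      ← Finset.mul_sum] at h_telescope
    have h_last : baileyEntry q 1 n n =
        (1 - q ^ (2 * (n + 1))) * baileyEntry q 0 (n + 1) (n + 1) := by
      rw [baileyEntry_self, baileyEntry_self, inv_qPoch_self hq (2 * n + 1)]
      rfl
    apply mul_left_cancel₀ h_factor
    dsimp only at ih ⊢
    rw [← inv_qPoch_self hq n, ← ih, Finset.sum_range_succ, slaterB1, if_neg n.succ_ne_zero]
    linear_combination h_telescope +
      (-1) ^ n * q ^ (n + 1 + 3 * (n + 1).choose 2) * h_last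

lemma slaterB3_mul_baileyEntry_succ (hq : ∀ n, q ^ (n + 1) ≠ 1) {n m : ℕ} (hm : m ≤ n) :
    slaterB3 q m * baileyEntry q 1 (n + 1) m =
      slaterB3 q m * baileyEntry q 1 n m + q ^ (n + 1) *
        ((-1) ^ m * q ^ (m + 3 * m.choose 2) * baileyEntry q 0 (n + 1) m +
          (-1) ^ (m + 1) * q ^ (2 * (m + 1) + 3 * (m + 1).choose 2) *
            baileyEntry q 0 (n + 1) (m + 1)) := by
  obtain ⟨t, rfl⟩ := Nat.exists_eq_add_of_le hm
  have h_next : baileyEntry q 0 (m + t + 1) (m + 1) =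
      (qPoch q q t)⁻¹ * (qPoch q q (t + 2 * m + 1 + 1))⁻¹ := by
    rw [add_right_comm, baileyEntry_add]
    congr 3
  rw [h_next, add_assoc m t 1, baileyEntry_add, baileyEntry_add, baileyEntry_add, add_zero,
    ← add_assoc, ← add_assoc, add_right_comm t 1 (2 * m), inv_qPoch_self hq t,
    inv_qPoch_self hq (t + 2 * m + 1), choose_two_succ, slaterB3]
  ring

lemma slaterB1_sum_split (q : ℂ) (n : ℕ) (w : ℕ → ℂ) :
    ∑ m ∈ Finset.range (n + 1), slaterB1 q m * w m =
      ∑ m ∈ Finset.range (n + 1), (-1) ^ m * q ^ (m + 3 * m.choose 2) * w m +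
      ∑ m ∈ Finset.range n,
        (-1) ^ (m + 1) * q ^ (2 * (m + 1) + 3 * (m + 1).choose 2) * w (m + 1) := by
  rw [Finset.sum_range_succ', Finset.sum_range_succ' _ n, add_right_comm,
    ← Finset.sum_add_distrib]
  congr 1
  · refine Finset.sum_congr rfl fun m _ => ?_
    rw [slaterB1, if_neg m.succ_ne_zero]
    ring
  · simp [slaterB1]

theorem isBaileyPair_slaterB3 (hq : ∀ n, q ^ (n + 1) ≠ 1) :
    IsBaileyPair q 1 (slaterB3 q) fun n => (qPoch q q n)⁻¹ := by
  intro n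
  induction n with
  | zero =>
    have h_factor : 1 - q ≠ 0 := sub_ne_zero.2 (by simpa using (hq 0).symm)
    simp [slaterB3, baileyEntry, qPoch_succ, h_factor]
  | succ n ih =>
    have h_last : slaterB3 q (n + 1) * baileyEntry q 1 (n + 1) (n + 1) = q ^ (n + 1) *
        ((-1) ^ (n + 1) * q ^ (n + 1 + 3 * (n + 1).choose 2) *
          baileyEntry q 0 (n + 1) (n + 1)) := by
      rw [baileyEntry_self, baileyEntry_self, add_zero, inv_qPoch_self hq (2 * (n + 1)), slaterB3]
      ring
    have h_B1 := isBaileyPair_slaterB1 hq (n + 1)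
    rw [slaterB1_sum_split, Finset.sum_range_succ] at h_B1
    dsimp only at ih h_B1 ⊢
    rw [Finset.sum_range_succ, Finset.sum_congr rfl fun m hm =>
      slaterB3_mul_baileyEntry_succ hq (Nat.lt_succ_iff.1 (Finset.mem_range.1 hm)),
      Finset.sum_add_distrib, ih, h_last, ← Finset.mul_sum, Finset.sum_add_distrib,
      inv_qPoch_self hq n]
    linear_combination q ^ (n + 1) * h_B1

end FiniteIdentities

section RogersRamanujan

variable {q : ℂ}

lemma summable_bailey (hq : ‖q‖ < 1) {e : ℕ} {α : ℕ → ℂ}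
    (hα : Summable fun m => α m * q ^ (m ^ 2 + e * m)) :
    Summable fun p : ℕ × ℕ => α p.1 * q ^ (p.1 ^ 2 + e * p.1) *
      (q ^ (p.2 ^ 2 + (2 * p.1 + e) * p.2) /
        (qPoch q q p.2 * qPoch q q (p.2 + (2 * p.1 + e)))) := by
  obtain ⟨C, hC⟩ := exists_norm_cauchyTerm_le hq
  have h_geom := (summable_geometric_of_lt_one (norm_nonneg q) hq).mul_right C
  refine .of_norm_bounded (hα.norm.mul_of_nonneg h_geom (fun _ => norm_nonneg _) fun t => ?_)
    fun p => ?_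
  · exact (norm_nonneg _).trans (hC 0 0 t)
  · rw [norm_mul]
    exact mul_le_mul_of_nonneg_left (hC _ _ _) (norm_nonneg _)

/-- The limiting case of Bailey's lemma in which both free parameters tend to infinity. -/
theorem IsBaileyPair.hasSum (hq : ‖q‖ < 1) {e : ℕ} {α β : ℕ → ℂ} (h : IsBaileyPair q e α β)
    {T : ℂ} (hT : HasSum (fun m => α m * q ^ (m ^ 2 + e * m)) T) :
    HasSum (fun n => q ^ (n ^ 2 + e * n) * β n) (T / qPochInf q q) := by
  have h_double := hasSum_of_hasSum_fiberwise (summable_bailey hq hT.summable)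
    (fun m => (hasSum_cauchy hq (2 * m + e)).mul_left (α m * q ^ (m ^ 2 + e * m)))
    (hT.mul_right (qPochInf q q)⁻¹)
  rw [div_eq_mul_inv]
  refine (hasSum_sum_antidiagonal h_double).congr_fun fun n => ?_
  rw [Finset.Nat.sum_antidiagonal_eq_sum_range_succ_mk, ← h n, Finset.mul_sum]
  refine Finset.sum_congr rfl fun m hm => ?_
  obtain ⟨t, rfl⟩ := Nat.exists_eq_add_of_le (Nat.lt_succ_iff.1 (Finset.mem_range.1 hm))
  rw [baileyEntry_add, Nat.add_sub_cancel_left, div_eq_mul_inv, mul_inv]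
  ring

/-- A sum-product identity of Rogers–Ramanujan type:
`∑ q^{s² + e s} / (q; q)_s = (q^u, q^v, q^{u+v}; q^{u+v})_∞ / (q; q)_∞`. -/
def IsRogersRamanujan (e u v : ℕ) : Prop :=
  ∀ q : ℂ, ‖q‖ < 1 → HasSum (fun s : ℕ => q ^ (s ^ 2 + e * s) / qPoch q q s)
    (qPochInf₃ (q ^ u) (q ^ v) (q ^ (u + v)) (q ^ (u + v)) / qPochInf q q)

lemma sq_eq_two_mul_choose_two_add (m : ℕ) : m ^ 2 = 2 * m.choose 2 + m := by
  have h := choose_two_mul_two m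
  zify
  linarith

lemma hasSum_slaterB1 (hq : ‖q‖ < 1) :
    HasSum (fun m => slaterB1 q m * q ^ (m ^ 2 + 0 * m))
      (qPochInf₃ (q ^ 2) (q ^ 3) (q ^ 5) (q ^ 5)) := by
  have h_jacobi := hasSum_jacobiTerm (norm_pow_lt_one hq two_ne_zero)
    (norm_pow_lt_one hq three_ne_zero)
  rw [← pow_add] at h_jacobi
  have h_fold := h_jacobi.nat_add_neg.sub (hasSum_ite_eq 0 (jacobiTerm (q ^ 2) (q ^ 3) 0))
  rw [add_sub_cancel_right] at h_fold
  refine h_fold.congr_fun fun m => ?_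
  rcases eq_or_ne m 0 with rfl | hm
  · simp [slaterB1, jacobiTerm, triangle]
  · rw [if_neg hm, jacobiTerm_neg, jacobiTerm_natCast, jacobiTerm_natCast, slaterB1, if_neg hm,
      sq_eq_two_mul_choose_two_add m]
    ring

lemma hasSum_slaterB3 (hq : ‖q‖ < 1) :
    HasSum (fun m => slaterB3 q m * q ^ (m ^ 2 + 1 * m))
      (qPochInf₃ (q ^ 1) (q ^ 4) (q ^ 5) (q ^ 5)) := by
  have h_jacobi := hasSum_jacobiTerm (norm_pow_lt_one hq (by norm_num : 4 ≠ 0))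
    (norm_pow_lt_one hq one_ne_zero)
  rw [← pow_add] at h_jacobi
  have h_swap : qPochInf₃ (q ^ 1) (q ^ 4) (q ^ 5) (q ^ 5) =
      qPochInf₃ (q ^ 4) (q ^ 1) (q ^ 5) (q ^ 5) := by
    rw [qPochInf₃, qPochInf₃, mul_comm (qPochInf (q ^ 1) (q ^ 5))]
  rw [h_swap]
  refine h_jacobi.nat_add_neg_add_one.congr_fun fun m => ?_
  rw [jacobiTerm_neg, ← Nat.cast_succ, Nat.succ_eq_add_one, jacobiTerm_natCast,
    jacobiTerm_natCast, slaterB3, sq_eq_two_mul_choose_two_add m, choose_two_succ]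
  ring

theorem isRogersRamanujan_zero : IsRogersRamanujan 0 2 3 := fun q hq => by
  simpa only [div_eq_mul_inv] using
    (isBaileyPair_slaterB1 (pow_succ_ne_one hq)).hasSum hq (hasSum_slaterB1 hq)

theorem isRogersRamanujan_one : IsRogersRamanujan 1 1 4 := fun q hq => by
  simpa only [div_eq_mul_inv] using
    (isBaileyPair_slaterB3 (pow_succ_ne_one hq)).hasSum hq (hasSum_slaterB3 hq)

end RogersRamanujan

/-! ### Splitting a summation index as `n = j + 2k` -/

/-- The sequence `b ↦ 1 / (q²; q²)_{b/2}` on even numbers, extended by `0`. -/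
def evenCoeff (q : ℂ) (b : ℕ) : ℂ := if Even b then (qPoch (q ^ 2) (q ^ 2) (b / 2))⁻¹ else 0

/-- The weight `q^{j(j-1)/2} / ((q; q)_j (q²; q²)_k)` of the pair `(j, k)`; these weights add up to
`1 / (q; q)_n` over the pairs with `j + 2k = n`. -/
def splitWeight (q : ℂ) (p : ℕ × ℕ) : ℂ :=
  q ^ p.1.choose 2 / (qPoch q q p.1 * qPoch (q ^ 2) (q ^ 2) p.2)

section Splitting

open PowerSeries

variable {q : ℂ}

lemma evenCoeff_two_mul (q : ℂ) (k : ℕ) :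
    evenCoeff q (2 * k) = (qPoch (q ^ 2) (q ^ 2) k)⁻¹ := by
  rw [evenCoeff, if_pos (even_two_mul k), Nat.mul_div_cancel_left k two_pos]

lemma evenCoeff_of_not_even (q : ℂ) {b : ℕ} (hb : ¬ Even b) : evenCoeff q b = 0 := if_neg hb

lemma evenCoeff_add_two (hq : ∀ n, q ^ (n + 1) ≠ 1) (b : ℕ) :
    evenCoeff q b = (1 - q ^ (b + 2)) * evenCoeff q (b + 2) := by
  rcases Nat.even_or_odd' b with ⟨k, rfl | rfl⟩
  · have hq_sq : ∀ n, (q ^ 2) ^ (n + 1) ≠ 1 := fun n => by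
      rw [← pow_mul]
      exact hq (2 * n + 1)
    rw [show 2 * k + 2 = 2 * (k + 1) by ring, evenCoeff_two_mul, evenCoeff_two_mul,
      inv_qPoch_self hq_sq k, pow_mul]
  · rw [evenCoeff_of_not_even q (by simp), evenCoeff_of_not_even q (by simp [Nat.even_add]),
      mul_zero]

lemma mk_euler_eq_mul_rescale (hq : ∀ n, q ^ (n + 1) ≠ 1) :
    mk (fun j => q ^ j.choose 2 / qPoch q q j) =
      (1 + X) * rescale q (mk fun j => q ^ j.choose 2 / qPoch q q j) := by
  ext j
  rcases j with _ | j
  · rw [add_mul, one_mul, map_add, coeff_zero_X_mul, coeff_rescale, pow_zero, one_mul, add_zero]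
  · simp only [add_mul, one_mul, map_add, coeff_succ_X_mul, coeff_rescale, coeff_mk, div_eq_mul_inv,
      inv_qPoch_self hq j, choose_two_succ]
    ring

lemma rescale_mk_evenCoeff (hq : ∀ n, q ^ (n + 1) ≠ 1) :
    rescale q (mk (evenCoeff q)) = (1 - X ^ 2) * mk (evenCoeff q) := by
  ext j
  rcases j with _ | _ | j
  · simp [sub_mul]
  · simp [sub_mul, coeff_X_pow_mul', evenCoeff]
  · rw [sub_mul, one_mul, map_sub, add_assoc, coeff_X_pow_mul, coeff_rescale, coeff_mk, coeff_mk,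
      evenCoeff_add_two hq j]
    ring

lemma coeff_eq_inv_qPoch_of_rescale (hq : ∀ n, q ^ (n + 1) ≠ 1) {H : PowerSeries ℂ}
    (h_zero : coeff 0 H = 1) (h_rescale : rescale q H = (1 - X) * H) (n : ℕ) :
    coeff n H = (qPoch q q n)⁻¹ := by
  induction n with
  | zero => rw [h_zero, qPoch_zero, inv_one]
  | succ n ih =>
    have h_coeff := congrArg (coeff (n + 1)) h_rescale
    rw [coeff_rescale, sub_mul, one_mul, map_sub, coeff_succ_X_mul, ih, inv_qPoch_self hq n]
      at h_coeff
    have h_factor : 1 - q ^ (n + 1) ≠ 0 := sub_ne_zero.2 (hq n).symm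
    apply mul_left_cancel₀ h_factor
    linear_combination -h_coeff

/-- The generating functions of both factors are eigenfunctions, up to a factor, of `X ↦ qX`; for
their product the factor is `1 - X`, which characterizes the generating function of
`1 / (q; q)_n`. -/
theorem sum_antidiagonal_evenCoeff (hq : ∀ n, q ^ (n + 1) ≠ 1) (n : ℕ) :
    ∑ p ∈ Finset.HasAntidiagonal.antidiagonal n,
      q ^ p.1.choose 2 / qPoch q q p.1 * evenCoeff q p.2 = (qPoch q q n)⁻¹ := by
  set F : PowerSeries ℂ := mk fun j => q ^ j.choose 2 / qPoch q q j with hF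
  set G : PowerSeries ℂ := mk (evenCoeff q) with hG
  have h_unit : (1 + X : PowerSeries ℂ) ≠ 0 := fun h => by
    simpa using congrArg (coeff 0) h
  have h_rescale : rescale q (F * G) = (1 - X) * (F * G) := by
    apply mul_left_cancel₀ h_unit
    rw [map_mul, rescale_mk_evenCoeff hq]
    linear_combination -((1 - X ^ 2) * G) * mk_euler_eq_mul_rescale hq
  rw [← coeff_eq_inv_qPoch_of_rescale hq (by simp [hF, hG, coeff_mul, evenCoeff]) h_rescale n,
    coeff_mul]
  simp only [hF, hG, coeff_mk]

lemma hasSum_splitWeight_mul (hq : ∀ n, q ^ (n + 1) ≠ 1) {φ : ℕ → ℂ} {a : ℂ}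
    (h_summable : Summable fun p : ℕ × ℕ => splitWeight q p * φ (p.1 + 2 * p.2))
    (h : HasSum (fun n => φ n / qPoch q q n) a) :
    HasSum (fun p : ℕ × ℕ => splitWeight q p * φ (p.1 + 2 * p.2)) a := by
  set g : ℕ × ℕ → ℂ := fun p =>
    q ^ p.1.choose 2 / qPoch q q p.1 * evenCoeff q p.2 * φ (p.1 + p.2) with hg
  have h_injective : Function.Injective fun p : ℕ × ℕ => (p.1, 2 * p.2) := by
    rintro ⟨j, k⟩ ⟨j', k'⟩ h
    simpa using h
  have h_split : HasSum g (∑' p : ℕ × ℕ, splitWeight q p * φ (p.1 + 2 * p.2)) := by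
    refine (h_injective.hasSum_iff ?_).1 (h_summable.hasSum.congr_fun fun p => ?_)
    · rintro ⟨j, b⟩ hb
      have h_odd : ¬ Even b := fun ⟨k, hk⟩ => hb ⟨(j, k), by simp [hk, two_mul]⟩
      simp [hg, evenCoeff_of_not_even q h_odd]
    · simp only [Function.comp_apply, hg, evenCoeff_two_mul, splitWeight, div_eq_mul_inv, mul_inv]
      ring
  have h_antidiagonal (n : ℕ) :
      φ n / qPoch q q n = ∑ p ∈ Finset.HasAntidiagonal.antidiagonal n, g p := by
    rw [div_eq_mul_inv, ← sum_antidiagonal_evenCoeff hq, Finset.mul_sum]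
    refine Finset.sum_congr rfl fun p hp => ?_
    rw [hg, ← Finset.HasAntidiagonal.mem_antidiagonal.1 hp, mul_comm]
  rw [h.unique ((hasSum_sum_antidiagonal h_split).congr_fun h_antidiagonal)]
  exact h_summable.hasSum

theorem hasSum_splitWeight_mul_prod (hq : ∀ n, q ^ (n + 1) ≠ 1) {β : Type*} {φ : β → ℕ → ℂ} {a : ℂ}
    (h_summable : Summable fun p : β × ℕ × ℕ =>
      splitWeight q p.2 * φ p.1 (p.2.1 + 2 * p.2.2))
    (h : HasSum (fun p : β × ℕ => φ p.1 p.2 / qPoch q q p.2) a) :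
    HasSum (fun p : β × ℕ × ℕ => splitWeight q p.2 * φ p.1 (p.2.1 + 2 * p.2.2)) a := by
  have h_fiber : ∀ b, HasSum (fun n => φ b n / qPoch q q n) (∑' n, φ b n / qPoch q q n) :=
    fun b => (h.summable.prod_factor b).hasSum
  have h_split : ∀ b, HasSum (fun p : ℕ × ℕ => splitWeight q p * φ b (p.1 + 2 * p.2))
      (∑' n, φ b n / qPoch q q n) :=
    fun b => hasSum_splitWeight_mul hq (h_summable.prod_factor b) (h_fiber b)
  exact hasSum_of_hasSum_fiberwise h_summable h_split (h.prod_fiberwise h_fiber)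

end Splitting

/-! ### Double and triple sums -/

/-- The exponent `i(i+1)/2 + ij + 2j² + 2ej`. The sum of `q^{doubleExponent e i j}` over
`(q; q)_i (q; q)_j` is the one to which all triple sums of index `(1, 1, 2)` below reduce. -/
def doubleExponent (e i j : ℕ) : ℕ := i.choose 2 + i + i * j + 2 * j ^ 2 + 2 * e * j

/-- The exponents of Example 1, with linear term `i/2 + j + 4ek`. -/
def exponent₁ (e i j k : ℕ) : ℕ := i.choose 2 + i + i * j + 2 * doubleExponent e j k

/-- The exponents of Example 6, with linear term `i/2 + (2e - 1/2)j + 4ek`. -/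
def exponent₆ (e i j k : ℕ) : ℕ := j.choose 2 + doubleExponent e i (j + 2 * k)

/-- The exponents of Example 7, with linear term `i/2 + 4ej + k`. -/
def exponent₇ (e i j k : ℕ) : ℕ := i.choose 2 + i + i * j + 2 * doubleExponent e k j

/-- The exponents of Example 10, with linear term `2ej + k`. -/
def exponent₁₀ (e i j k : ℕ) : ℕ := i.choose 2 + doubleExponent e (i + 2 * k) j

/-- The terms of a triple sum of index `(1, 1, 2)` with exponents given as natural numbers. -/
def index112Term (q : ℂ) (E : ℕ → ℕ → ℕ → ℕ) (n : ℕ × ℕ × ℕ) : ℂ :=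
  q ^ E n.1 n.2.1 n.2.2 / (qPoch q q n.1 * qPoch q q n.2.1 * qPoch (q ^ 2) (q ^ 2) n.2.2)

section Exponents

lemma add_le_doubleExponent (e i j : ℕ) : i + j ≤ doubleExponent e i j := by
  have h_sq := Nat.le_self_pow two_ne_zero j
  unfold doubleExponent
  nlinarith [Nat.zero_le (i.choose 2), Nat.zero_le (i * j), Nat.zero_le (e * j)]

variable {K : Type*} [Field K] [CharZero K] (e i j k : ℕ)

lemma exponent₁_cast :
    (exponent₁ e i j k : K) =
      1 / 2 * i ^ 2 + j ^ 2 + 4 * k ^ 2 + i * j + 2 * j * k + 1 / 2 * i + j + 4 * e * k := by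
  rw [exponent₁, doubleExponent]
  push_cast [Nat.cast_choose_two]
  ring

lemma exponent₆_cast :
    (exponent₆ e i j k : K) =
      1 / 2 * i ^ 2 + 5 / 2 * j ^ 2 + 8 * k ^ 2 + i * j + 2 * i * k + 8 * j * k + 1 / 2 * i +
        (2 * e - 1 / 2) * j + 4 * e * k := by
  rw [exponent₆, doubleExponent]
  push_cast [Nat.cast_choose_two]
  ring

lemma exponent₇_cast :
    (exponent₇ e i j k : K) =
      1 / 2 * i ^ 2 + 4 * j ^ 2 + k ^ 2 + i * j + 2 * j * k + 1 / 2 * i + 4 * e * j + k := by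
  rw [exponent₇, doubleExponent]
  push_cast [Nat.cast_choose_two]
  ring

lemma exponent₁₀_cast :
    (exponent₁₀ e i j k : K) =
      i ^ 2 + 2 * j ^ 2 + 2 * k ^ 2 + i * j + 2 * i * k + 2 * j * k + 2 * e * j + k := by
  rw [exponent₁₀, doubleExponent]
  push_cast [Nat.cast_choose_two]
  ring

end Exponents

section Sums

variable {q : ℂ}

lemma hasIndex112Sum_of_natCast {E : ℂ → ℂ → ℂ → ℂ} {N : ℕ → ℕ → ℕ → ℕ} {P : ℂ}
    (h : HasSum (index112Term q N) P) (hE : ∀ i j k : ℕ, (N i j k : ℂ) = E i j k) :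
    HasIndex112Sum q E P := by
  refine h.congr_fun fun n => ?_
  rw [index112Term, ← hE, Complex.cpow_natCast]

lemma summable_div_qPoch_mul_qPoch (hq : ‖q‖ < 1) {N : ℕ → ℕ → ℕ} (hN : ∀ i j, i + j ≤ N i j) :
    Summable fun p : ℕ × ℕ => q ^ N p.1 p.2 / (qPoch q q p.1 * qPoch q q p.2) := by
  obtain ⟨C, hC_nonneg, hC⟩ := exists_norm_inv_qPoch_self_le hq
  have h_geom := summable_geometric_of_lt_one (norm_nonneg q) hq
  have h_geom₂ := h_geom.mul_of_nonneg h_geom (fun _ => by positivity) (fun _ => by positivity)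
  refine .of_norm_bounded (h_geom₂.mul_right (C * C)) fun p => ?_
  rw [div_eq_mul_inv, mul_inv, norm_mul, norm_mul, ← pow_add]
  gcongr
  exacts [norm_pow_le_norm_pow hq (hN _ _), hC _, hC _]

lemma summable_index112Term (hq : ‖q‖ < 1) {N : ℕ → ℕ → ℕ → ℕ}
    (hN : ∀ i j k, i + (j + k) ≤ N i j k) : Summable (index112Term q N) := by
  obtain ⟨C, hC_nonneg, hC⟩ := exists_norm_inv_qPoch_self_le hq
  obtain ⟨D, -, hD⟩ := exists_norm_inv_qPoch_self_le (norm_pow_lt_one hq two_ne_zero)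
  have h_geom := summable_geometric_of_lt_one (norm_nonneg q) hq
  have h_geom₂ := h_geom.mul_of_nonneg h_geom (fun _ => by positivity) (fun _ => by positivity)
  have h_geom₃ := h_geom.mul_of_nonneg h_geom₂ (fun _ => by positivity) (fun _ => by positivity)
  refine .of_norm_bounded (h_geom₃.mul_right (C * C * D)) fun n => ?_
  rw [index112Term, div_eq_mul_inv, mul_inv, mul_inv, norm_mul, norm_mul, norm_mul, ← pow_add,
    ← pow_add]
  gcongr
  exacts [norm_pow_le_norm_pow hq (hN _ _ _), hC _, hC _, hD _]

lemma hasSum_of_hasSum_fiberwise_snd {β γ : Type*} {f : β × γ → ℂ} {g : γ → ℂ} {a : ℂ}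
    (hf : Summable f) (h_fiber : ∀ c, HasSum (fun b => f (b, c)) (g c)) (hg : HasSum g a) :
    HasSum f a :=
  (Equiv.prodComm γ β).hasSum_iff.1
    (hasSum_of_hasSum_fiberwise ((Equiv.prodComm γ β).summable_iff.2 hf) h_fiber hg)

lemma hasSum_euler_shift (hq : ‖q‖ < 1) (j : ℕ) :
    HasSum (fun i : ℕ => q ^ (i.choose 2 + i + i * j) / qPoch q q i)
      (qPochInf (-q) q * (qPoch (-q) q j)⁻¹) := by
  have h_ne := qPoch_ne_zero ((norm_neg q).trans_lt hq) hq j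
  have h_euler := hasSum_euler hq (norm_pow_lt_one hq j.succ_ne_zero)
  rw [← qPoch_mul_qPochInf (-q) hq j, mul_comm, inv_mul_cancel_left₀ h_ne, neg_mul, ← pow_succ']
  refine h_euler.congr_fun fun i => ?_
  rw [← pow_mul, ← pow_add]
  congr 2
  rw [Nat.succ_eq_add_one]
  ring

lemma inv_qPoch_sq (q : ℂ) (n : ℕ) :
    (qPoch (q ^ 2) (q ^ 2) n)⁻¹ = (qPoch (-q) q n)⁻¹ * (qPoch q q n)⁻¹ := by
  rw [← qPoch_mul_qPoch_neg, mul_inv_rev]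

lemma qPochInf_neg_mul_div_qPochInf_sq (hq : ‖q‖ < 1) (T : ℂ) :
    qPochInf (-q) q * (T / qPochInf (q ^ 2) (q ^ 2)) = T / qPochInf q q := by
  have h_ne := qPochInf_ne_zero ((norm_neg q).trans_lt hq) hq
  rw [← qPochInf_mul_qPochInf_neg hq, mul_div_assoc', mul_comm, mul_div_mul_right _ _ h_ne]

variable {e u v : ℕ}

/-- Summation over `i` by Euler's identity turns `1 / (q; q)_j` into a multiple of
`1 / (q²; q²)_j`, which leaves a Rogers–Ramanujan sum in the variable `q²`. -/
theorem IsRogersRamanujan.hasSum_doubleExponent (h : IsRogersRamanujan e u v) (hq : ‖q‖ < 1) :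
    HasSum (fun p : ℕ × ℕ => q ^ doubleExponent e p.1 p.2 / (qPoch q q p.1 * qPoch q q p.2))
      (qPochInf₃ (q ^ (2 * u)) (q ^ (2 * v)) (q ^ (2 * (u + v))) (q ^ (2 * (u + v))) /
        qPochInf q q) := by
  have h_sq := (h (q ^ 2) (norm_pow_lt_one hq two_ne_zero)).mul_left (qPochInf (-q) q)
  rw [qPochInf_neg_mul_div_qPochInf_sq hq] at h_sq
  simp only [← pow_mul] at h_sq
  refine hasSum_of_hasSum_fiberwise_snd
    (summable_div_qPoch_mul_qPoch hq (add_le_doubleExponent e)) (fun j => ?_) h_sq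
  have h_fiber := (hasSum_euler_shift hq j).mul_right (q ^ (2 * (j ^ 2 + e * j)) * (qPoch q q j)⁻¹)
  have h_value :
      qPochInf (-q) q * (q ^ (2 * (j ^ 2 + e * j)) / qPoch (q ^ 2) (q ^ 2) j) =
        qPochInf (-q) q * (qPoch (-q) q j)⁻¹ * (q ^ (2 * (j ^ 2 + e * j)) * (qPoch q q j)⁻¹) := by
    rw [div_eq_mul_inv, inv_qPoch_sq]
    ring
  rw [h_value]
  refine h_fiber.congr_fun fun i => ?_
  rw [doubleExponent, div_eq_mul_inv, div_eq_mul_inv, mul_inv]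
  ring

lemma hasSum_index112Term_of_euler (hq : ‖q‖ < 1) {N : ℕ → ℕ → ℕ} (hN : ∀ j k, j + k ≤ N j k)
    {T : ℂ} (h : HasSum (fun p : ℕ × ℕ => (q ^ 2) ^ N p.1 p.2 /
      (qPoch (q ^ 2) (q ^ 2) p.1 * qPoch (q ^ 2) (q ^ 2) p.2)) (T / qPochInf (q ^ 2) (q ^ 2))) :
    HasSum (index112Term q fun i j k => i.choose 2 + i + i * j + 2 * N j k) (T / qPochInf q q) := by
  have h_summable : Summable (index112Term q fun i j k => i.choose 2 + i + i * j + 2 * N j k) :=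
    summable_index112Term hq fun i j k => by
      linarith [Nat.zero_le (i.choose 2), Nat.zero_le (i * j), hN j k]
  rw [← qPochInf_neg_mul_div_qPochInf_sq hq]
  refine hasSum_of_hasSum_fiberwise_snd h_summable (fun p => ?_) (h.mul_left _)
  have h_fiber := (hasSum_euler_shift hq p.1).mul_right
    (q ^ (2 * N p.1 p.2) * (qPoch q q p.1)⁻¹ * (qPoch (q ^ 2) (q ^ 2) p.2)⁻¹)
  have h_value : qPochInf (-q) q * ((q ^ 2) ^ N p.1 p.2 /
      (qPoch (q ^ 2) (q ^ 2) p.1 * qPoch (q ^ 2) (q ^ 2) p.2)) =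
      qPochInf (-q) q * (qPoch (-q) q p.1)⁻¹ *
        (q ^ (2 * N p.1 p.2) * (qPoch q q p.1)⁻¹ * (qPoch (q ^ 2) (q ^ 2) p.2)⁻¹) := by
    rw [div_eq_mul_inv, mul_inv, inv_qPoch_sq q p.1, ← pow_mul]
    ring
  rw [h_value]
  refine h_fiber.congr_fun fun i => ?_
  simp only [index112Term, div_eq_mul_inv, mul_inv]
  ring

theorem IsRogersRamanujan.hasSum_doubleExponent_sq (h : IsRogersRamanujan e u v) (hq : ‖q‖ < 1) :
    HasSum (fun p : ℕ × ℕ => (q ^ 2) ^ doubleExponent e p.1 p.2 /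
        (qPoch (q ^ 2) (q ^ 2) p.1 * qPoch (q ^ 2) (q ^ 2) p.2))
      (qPochInf₃ (q ^ (4 * u)) (q ^ (4 * v)) (q ^ (4 * (u + v))) (q ^ (4 * (u + v))) /
        qPochInf (q ^ 2) (q ^ 2)) := by
  simpa only [← pow_mul, ← mul_assoc, Nat.reduceMul] using
    h.hasSum_doubleExponent (norm_pow_lt_one hq two_ne_zero)

theorem IsRogersRamanujan.hasSum_exponent₁ (h : IsRogersRamanujan e u v) (hq : ‖q‖ < 1) :
    HasSum (index112Term q (exponent₁ e))
      (qPochInf₃ (q ^ (4 * u)) (q ^ (4 * v)) (q ^ (4 * (u + v))) (q ^ (4 * (u + v))) /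
        qPochInf q q) :=
  hasSum_index112Term_of_euler hq (add_le_doubleExponent e) (h.hasSum_doubleExponent_sq hq)

theorem IsRogersRamanujan.hasSum_exponent₇ (h : IsRogersRamanujan e u v) (hq : ‖q‖ < 1) :
    HasSum (index112Term q (exponent₇ e))
      (qPochInf₃ (q ^ (4 * u)) (q ^ (4 * v)) (q ^ (4 * (u + v))) (q ^ (4 * (u + v))) /
        qPochInf q q) := by
  refine hasSum_index112Term_of_euler hq (N := fun j k => doubleExponent e k j)
    (fun j k => (add_comm j k).trans_le (add_le_doubleExponent e k j)) ?_
  refine ((Equiv.prodComm ℕ ℕ).hasSum_iff.2 (h.hasSum_doubleExponent_sq hq)).congr_fun fun p => ?_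
  rw [Function.comp_apply, Equiv.prodComm_apply, Prod.fst_swap, Prod.snd_swap,
    mul_comm (qPoch (q ^ 2) (q ^ 2) p.1)]

theorem IsRogersRamanujan.hasSum_exponent₆ (h : IsRogersRamanujan e u v) (hq : ‖q‖ < 1) :
    HasSum (index112Term q (exponent₆ e))
      (qPochInf₃ (q ^ (2 * u)) (q ^ (2 * v)) (q ^ (2 * (u + v))) (q ^ (2 * (u + v))) /
        qPochInf q q) := by
  have h_summable : Summable (index112Term q (exponent₆ e)) :=
    summable_index112Term hq fun i j k => by
      rw [exponent₆]
      linarith [Nat.zero_le (j.choose 2), add_le_doubleExponent e i (j + 2 * k)]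
  have h_term : index112Term q (exponent₆ e) = fun p => splitWeight q p.2 *
      (q ^ doubleExponent e p.1 (p.2.1 + 2 * p.2.2) * (qPoch q q p.1)⁻¹) := by
    funext p
    simp only [index112Term, exponent₆, splitWeight, div_eq_mul_inv, mul_inv]
    ring
  rw [h_term] at h_summable ⊢
  refine hasSum_splitWeight_mul_prod (pow_succ_ne_one hq) h_summable
    (φ := fun i n => q ^ doubleExponent e i n * (qPoch q q i)⁻¹)
    ((h.hasSum_doubleExponent hq).congr_fun fun p => ?_)
  rw [div_mul_eq_div_div, div_eq_mul_inv (_ ^ _)]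

/-- Exchanges the first two of three indices. -/
def swapFirstTwo : ℕ × ℕ × ℕ ≃ ℕ × ℕ × ℕ where
  toFun p := (p.2.1, p.1, p.2.2)
  invFun p := (p.2.1, p.1, p.2.2)

theorem IsRogersRamanujan.hasSum_exponent₁₀ (h : IsRogersRamanujan e u v) (hq : ‖q‖ < 1) :
    HasSum (index112Term q (exponent₁₀ e))
      (qPochInf₃ (q ^ (2 * u)) (q ^ (2 * v)) (q ^ (2 * (u + v))) (q ^ (2 * (u + v))) /
        qPochInf q q) := by
  have h_summable : Summable (index112Term q (exponent₁₀ e)) :=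
    summable_index112Term hq fun i j k => by
      rw [exponent₁₀]
      linarith [Nat.zero_le (i.choose 2), add_le_doubleExponent e (i + 2 * k) j]
  have h_term : index112Term q (exponent₁₀ e) ∘ swapFirstTwo = fun p => splitWeight q p.2 *
      (q ^ doubleExponent e (p.2.1 + 2 * p.2.2) p.1 * (qPoch q q p.1)⁻¹) := by
    funext p
    simp only [index112Term, exponent₁₀, splitWeight, swapFirstTwo, Function.comp_apply,
      Equiv.coe_fn_mk, div_eq_mul_inv, mul_inv]
    ring
  rw [← swapFirstTwo.summable_iff, h_term] at h_summable
  rw [← swapFirstTwo.hasSum_iff, h_term]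
  refine hasSum_splitWeight_mul_prod (pow_succ_ne_one hq) h_summable
    (φ := fun j n => q ^ doubleExponent e n j * (qPoch q q j)⁻¹)
    (((Equiv.prodComm ℕ ℕ).hasSum_iff.2 (h.hasSum_doubleExponent hq)).congr_fun fun p => ?_)
  simp only [Function.comp_apply, Equiv.prodComm_apply, Prod.fst_swap, Prod.snd_swap,
    div_eq_mul_inv, mul_inv]
  ring

theorem IsRogersRamanujan.hasIndex112Sum₁ (h : IsRogersRamanujan e u v) (hq : ‖q‖ < 1) :
    HasIndex112Sum q (fun i j k =>
        1 / 2 * i ^ 2 + j ^ 2 + 4 * k ^ 2 + i * j + 2 * j * k + 1 / 2 * i + j + 4 * e * k)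
      (qPochInf₃ (q ^ (4 * u)) (q ^ (4 * v)) (q ^ (4 * (u + v))) (q ^ (4 * (u + v))) /
        qPochInf q q) :=
  hasIndex112Sum_of_natCast (h.hasSum_exponent₁ hq) (exponent₁_cast e)

theorem IsRogersRamanujan.hasIndex112Sum₆ (h : IsRogersRamanujan e u v) (hq : ‖q‖ < 1) :
    HasIndex112Sum q (fun i j k =>
        1 / 2 * i ^ 2 + 5 / 2 * j ^ 2 + 8 * k ^ 2 + i * j + 2 * i * k + 8 * j * k + 1 / 2 * i +
          (2 * e - 1 / 2) * j + 4 * e * k)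
      (qPochInf₃ (q ^ (2 * u)) (q ^ (2 * v)) (q ^ (2 * (u + v))) (q ^ (2 * (u + v))) /
        qPochInf q q) :=
  hasIndex112Sum_of_natCast (h.hasSum_exponent₆ hq) (exponent₆_cast e)

theorem IsRogersRamanujan.hasIndex112Sum₇ (h : IsRogersRamanujan e u v) (hq : ‖q‖ < 1) :
    HasIndex112Sum q (fun i j k =>
        1 / 2 * i ^ 2 + 4 * j ^ 2 + k ^ 2 + i * j + 2 * j * k + 1 / 2 * i + 4 * e * j + k)
      (qPochInf₃ (q ^ (4 * u)) (q ^ (4 * v)) (q ^ (4 * (u + v))) (q ^ (4 * (u + v))) /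
        qPochInf q q) :=
  hasIndex112Sum_of_natCast (h.hasSum_exponent₇ hq) (exponent₇_cast e)

theorem IsRogersRamanujan.hasIndex112Sum₁₀ (h : IsRogersRamanujan e u v) (hq : ‖q‖ < 1) :
    HasIndex112Sum q (fun i j k =>
        i ^ 2 + 2 * j ^ 2 + 2 * k ^ 2 + i * j + 2 * i * k + 2 * j * k + 2 * e * j + k)
      (qPochInf₃ (q ^ (2 * u)) (q ^ (2 * v)) (q ^ (2 * (u + v))) (q ^ (2 * (u + v))) /
        qPochInf q q) :=
  hasIndex112Sum_of_natCast (h.hasSum_exponent₁₀ hq) (exponent₁₀_cast e)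

end Sums

/-! ### Theta functions with rational characteristics -/

/-- The theta function `∑ exp(πi (n + r)² τ + 2πi n s)` with characteristics `r`, `s`. The usual
normalisation has `2πi (n + r) s` in the exponent; the one chosen here is periodic in `s`. -/
def thetaChar (r s τ : ℂ) : ℂ :=
  Complex.exp (Real.pi * Complex.I * r ^ 2 * τ) * jacobiTheta₂ (r * τ + s) τ

section ThetaChar

lemma jacobiTheta₂_add_one_right (z τ : ℂ) :
    jacobiTheta₂ z (τ + 1) = jacobiTheta₂ (z + 1 / 2) τ := by
  refine tsum_congr fun n => ?_
  rw [jacobiTheta₂_term, jacobiTheta₂_term, Complex.exp_eq_exp_iff_exists_int]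
  obtain ⟨k, hk⟩ : Even (n * (n - 1)) := Int.even_mul_pred_self n
  refine ⟨k, ?_⟩
  have h_cast : (n : ℂ) * (n - 1) = k + k := by exact_mod_cast hk
  linear_combination Real.pi * Complex.I * h_cast

lemma thetaChar_add_one (r s τ : ℂ) :
    thetaChar r s (τ + 1) =
      Complex.exp (Real.pi * Complex.I * r ^ 2) * thetaChar r (s + r + 1 / 2) τ := by
  rw [thetaChar, thetaChar, jacobiTheta₂_add_one_right, ← mul_assoc, ← Complex.exp_add]
  congr 2 <;> ring

lemma thetaChar_neg_inv (r s : ℂ) {τ : ℂ} (hτ : τ ≠ 0) :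
    thetaChar r s (-1 / τ) = (-Complex.I * τ) ^ (1 / 2 : ℂ) *
      Complex.exp (-2 * Real.pi * Complex.I * (r * s)) * thetaChar s (-r) τ := by
  have h_point : r * (-1 / τ) + s = (s * τ + -r) / τ := by
    field_simp
    ring
  have h_exp : Complex.exp (Real.pi * Complex.I * r ^ 2 * (-1 / τ)) =
      Complex.exp (-2 * Real.pi * Complex.I * (r * s)) *
        Complex.exp (Real.pi * Complex.I * s ^ 2 * τ) *
        Complex.exp (-Real.pi * Complex.I * (s * τ + -r) ^ 2 / τ) := by
    rw [← Complex.exp_add, ← Complex.exp_add]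
    congr 1
    field_simp
    ring
  rw [thetaChar, thetaChar, jacobiTheta₂_functional_equation (s * τ + -r) τ, h_point, h_exp]
  field_simp

lemma thetaChar_add_one_left (r s τ : ℂ) :
    thetaChar (r + 1) s τ = Complex.exp (-2 * Real.pi * Complex.I * s) * thetaChar r s τ := by
  have h_point : (r + 1) * τ + s = (r * τ + s) + τ := by ring
  rw [thetaChar, thetaChar, h_point, jacobiTheta₂_add_left', ← mul_assoc, ← mul_assoc,
    ← Complex.exp_add, ← Complex.exp_add]
  congr 2
  ring

lemma thetaChar_add_one_middle (r s τ : ℂ) : thetaChar r (s + 1) τ = thetaChar r s τ := by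
  rw [thetaChar, thetaChar, ← add_assoc, jacobiTheta₂_add_left]

lemma differentiableAt_thetaChar (r s : ℂ) {τ : ℂ} (hτ : 0 < τ.im) :
    DifferentiableAt ℂ (thetaChar r s) τ := by
  have h_theta : DifferentiableAt ℂ (fun z => jacobiTheta₂ (r * z + s) z) τ :=
    (hasFDerivAt_jacobiTheta₂ (r * τ + s) hτ).differentiableAt.comp τ
      (f := fun z : ℂ => (r * z + s, z)) (by fun_prop)
  exact DifferentiableAt.mul (by fun_prop) h_theta

lemma norm_exp_mul_jacobiTheta₂_term (r s : ℝ) (τ : ℂ) (n : ℤ) :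
    ‖Complex.exp (Real.pi * Complex.I * r ^ 2 * τ) * jacobiTheta₂_term n (r * τ + s) τ‖ =
      Real.exp (-Real.pi * (n + r) ^ 2 * τ.im) := by
  have h_re : (Real.pi * Complex.I * (r : ℂ) ^ 2 * τ).re = -Real.pi * r ^ 2 * τ.im := by
    have h_real : Real.pi * Complex.I * (r : ℂ) ^ 2 * τ =
        ((Real.pi * r ^ 2 : ℝ) : ℂ) * (Complex.I * τ) := by
      push_cast
      ring
    rw [h_real, Complex.re_ofReal_mul, Complex.I_mul_re]
    ring
  have h_im : ((r : ℂ) * τ + s).im = r * τ.im := by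
    rw [Complex.add_im, Complex.im_ofReal_mul, Complex.ofReal_im, add_zero]
  rw [norm_mul, norm_jacobiTheta₂_term, Complex.norm_exp, ← Real.exp_add, h_re, h_im]
  congr 1
  ring

lemma exists_norm_thetaChar_le (r s : ℝ) {c : ℝ} (hc : 0 < c) :
    ∃ B : ℝ, ∀ τ : ℂ, c ≤ τ.im → ‖thetaChar r s τ‖ ≤ B := by
  have h_im : ((c : ℂ) * Complex.I).im = c := by simp
  have h_summable : Summable fun n : ℤ => Real.exp (-Real.pi * (n + r) ^ 2 * c) := by
    have h := ((summable_jacobiTheta₂_term_iff (r * (c * Complex.I) + s) (c * Complex.I)).2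
      (h_im.symm ▸ hc)).mul_left (Complex.exp (Real.pi * Complex.I * r ^ 2 * (c * Complex.I)))
    refine h.norm.congr fun n => ?_
    rw [norm_exp_mul_jacobiTheta₂_term, h_im]
  refine ⟨∑' n : ℤ, Real.exp (-Real.pi * (n + r) ^ 2 * c), fun τ hτ => ?_⟩
  rw [thetaChar, jacobiTheta₂, ← tsum_mul_left]
  refine tsum_of_norm_bounded h_summable.hasSum fun n => ?_
  rw [norm_exp_mul_jacobiTheta₂_term, Real.exp_le_exp, neg_mul, neg_mul, neg_mul, neg_le_neg_iff]
  gcongr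

end ThetaChar

/-- The power of exponent `24(2l)²`, hence of weight `12(2l)²`, of a theta function with
characteristics in `(1/2l)ℤ`. The exponent is chosen to kill all roots of unity occurring in the
transformation laws. -/
def thetaPow (l : ℕ) (a b : ℤ) (τ : ℂ) : ℂ :=
  thetaChar ((a : ℂ) / (2 * l)) ((b : ℂ) / (2 * l)) τ ^ (24 * (2 * l) ^ 2)

section ThetaPow

lemma exp_pow_eq_one {x : ℂ} {n : ℕ} (k : ℤ) (h : n * x = k * (2 * Real.pi * Complex.I)) :
    Complex.exp x ^ n = 1 := by
  rw [← Complex.exp_nat_mul, Complex.exp_eq_one_iff]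
  exact ⟨k, h⟩

lemma cpow_half_pow_eq_pow (τ : ℂ) (m : ℕ) :
    ((-Complex.I * τ) ^ (1 / 2 : ℂ)) ^ (24 * m) = τ ^ (12 * m) := by
  have h_half : 24 * m = 2 * (12 * m) := by ring
  have h_I : (-Complex.I) ^ 12 = 1 := by
    rw [show 12 = 4 * 3 from rfl, pow_mul, Even.neg_pow (by decide), Complex.I_pow_four, one_pow]
  rw [h_half, pow_mul, ← Complex.cpow_nat_mul, Nat.cast_ofNat, mul_one_div_cancel two_ne_zero,
    Complex.cpow_one, mul_pow, pow_mul (-Complex.I), h_I, one_pow, one_mul]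

variable {l : ℕ} (hl : l ≠ 0)
include hl

lemma add_two_mul_div_two_mul (a : ℤ) :
    ((a + (2 * l : ℕ) : ℤ) : ℂ) / (2 * l) = (a : ℂ) / (2 * l) + 1 := by
  have hl₀ : (l : ℂ) ≠ 0 := Nat.cast_ne_zero.2 hl
  push_cast
  field_simp

lemma thetaPow_add_one (a b : ℤ) (τ : ℂ) :
    thetaPow l a b (τ + 1) = thetaPow l a (b + a + l) τ := by
  have hl₀ : (l : ℂ) ≠ 0 := Nat.cast_ne_zero.2 hl
  rw [thetaPow, thetaPow, thetaChar_add_one, mul_pow, exp_pow_eq_one (12 * a ^ 2), one_mul]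
  · congr 2
    push_cast
    field_simp
  · push_cast
    field_simp
    ring

lemma thetaPow_neg_inv (a b : ℤ) {τ : ℂ} (hτ : τ ≠ 0) :
    thetaPow l a b (-1 / τ) = τ ^ (12 * (2 * l) ^ 2) * thetaPow l b (-a) τ := by
  have hl₀ : (l : ℂ) ≠ 0 := Nat.cast_ne_zero.2 hl
  rw [thetaPow, thetaPow, thetaChar_neg_inv _ _ hτ, mul_pow, mul_pow, cpow_half_pow_eq_pow,
    exp_pow_eq_one (-24 * (a * b)), mul_one, Int.cast_neg, neg_div]
  push_cast
  field_simp

lemma thetaPow_periodic_left (b : ℤ) (τ : ℂ) :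
    Function.Periodic (fun a => thetaPow l a b τ) (2 * l : ℕ) := by
  intro a
  have hl₀ : (l : ℂ) ≠ 0 := Nat.cast_ne_zero.2 hl
  simp only [thetaPow]
  rw [add_two_mul_div_two_mul hl, thetaChar_add_one_left, mul_pow,
    exp_pow_eq_one (-24 * (2 * l) * b), one_mul]
  push_cast
  field_simp

lemma thetaPow_periodic_right (a : ℤ) (τ : ℂ) :
    Function.Periodic (fun b => thetaPow l a b τ) (2 * l : ℕ) := by
  intro b
  simp only [thetaPow]
  rw [add_two_mul_div_two_mul hl, thetaChar_add_one_middle]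

omit hl in
lemma exists_norm_thetaPow_le (a b : ℤ) {c : ℝ} (hc : 0 < c) :
    ∃ B : ℝ, ∀ τ : ℂ, c ≤ τ.im → ‖thetaPow l a b τ‖ ≤ B := by
  obtain ⟨B, hB⟩ := exists_norm_thetaChar_le (a / (2 * l)) (b / (2 * l)) hc
  push_cast at hB
  refine ⟨B ^ (24 * (2 * l) ^ 2), fun τ hτ => ?_⟩
  rw [thetaPow, norm_pow]
  gcongr
  exact hB τ hτ

end ThetaPow

lemma finite_range_of_periodic {α : Type*} {f : ℤ → ℤ → α} {L : ℕ} (hL : L ≠ 0)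
    (h_left : ∀ b, Function.Periodic (fun a => f a b) L)
    (h_right : ∀ a, Function.Periodic (f a) L) :
    (Set.range fun p : ℤ × ℤ => f p.1 p.2).Finite := by
  have hL_pos : (0 : ℤ) < L := by exact_mod_cast Nat.pos_of_ne_zero hL
  have h_emod_mem (a : ℤ) : a % L ∈ Set.Ico (0 : ℤ) L :=
    ⟨Int.emod_nonneg _ hL_pos.ne', Int.emod_lt_of_pos _ hL_pos⟩
  have h_emod {g : ℤ → α} (hg : Function.Periodic g L) (a : ℤ) : g (a % L) = g a := by
    conv_rhs => rw [← Int.emod_add_mul_ediv a L, mul_comm]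
    exact (hg.int_mul (a / L) (a % L)).symm
  refine (((Set.finite_Ico (0 : ℤ) L).prod (Set.finite_Ico (0 : ℤ) L)).image
    fun p : ℤ × ℤ => f p.1 p.2).subset ?_
  rintro _ ⟨⟨a, b⟩, rfl⟩
  exact ⟨(a % L, b % L), ⟨h_emod_mem a, h_emod_mem b⟩,
    (h_emod (h_right _) b).trans (h_emod (h_left b) a)⟩

/-! ### The action of the modular group -/

/-- The quotient, of weight zero, of `thetaPow l a b` by a power of the discriminant. -/
def thetaQuot (l : ℕ) (a b : ℤ) (τ : ℍ) : ℂ :=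
  thetaPow l a b τ / ModularForm.discriminant τ ^ (2 * l) ^ 2

section ModularGroup

lemma coe_SL_smul (γ : SL(2, ℤ)) (τ : ℍ) :
    ((γ • τ : ℍ) : ℂ) = ((γ 0 0 : ℂ) * τ + γ 0 1) / ((γ 1 0 : ℂ) * τ + γ 1 1) := by
  rw [UpperHalfPlane.coe_specialLinearGroup_apply]
  simp

lemma denom_SL_ne_zero (γ : SL(2, ℤ)) (τ : ℍ) : (γ 1 0 : ℂ) * τ + γ 1 1 ≠ 0 := by
  rw [← ModularGroup.denom_apply]
  exact UpperHalfPlane.denom_ne_zero _ _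

lemma discriminant_smul (γ : SL(2, ℤ)) (τ : ℍ) :
    ModularForm.discriminant (γ • τ) =
      ((γ 1 0 : ℂ) * τ + γ 1 1) ^ 12 * ModularForm.discriminant τ := by
  have hγ : (γ : GL (Fin 2) ℝ) ∈ 𝒮ℒ := ⟨γ, rfl⟩
  have h := SlashInvariantForm.slash_action_eqn'' CuspForm.discriminant hγ τ
  rw [ModularGroup.denom_apply] at h
  simpa using h

lemma coe_T_smul (τ : ℍ) : ((ModularGroup.T • τ : ℍ) : ℂ) = τ + 1 := by
  rw [UpperHalfPlane.modular_T_smul, UpperHalfPlane.coe_vadd, Complex.ofReal_one, add_comm]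

lemma coe_S_smul (τ : ℍ) : ((ModularGroup.S • τ : ℍ) : ℂ) = -1 / τ := by
  rw [UpperHalfPlane.modular_S_smul, UpperHalfPlane.coe_mk, inv_neg, neg_div, one_div]

variable {l : ℕ} (hl : l ≠ 0)
include hl

lemma thetaQuot_T_smul (a b : ℤ) (τ : ℍ) :
    thetaQuot l a b (ModularGroup.T • τ) = thetaQuot l a (b + a + l) τ := by
  have h_disc : ModularForm.discriminant (ModularGroup.T • τ) = ModularForm.discriminant τ := by
    rw [discriminant_smul]
    simp [ModularGroup.T]
  rw [thetaQuot, thetaQuot, h_disc, coe_T_smul, thetaPow_add_one hl]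

lemma thetaQuot_S_smul (a b : ℤ) (τ : ℍ) :
    thetaQuot l a b (ModularGroup.S • τ) = thetaQuot l b (-a) τ := by
  have h_disc : ModularForm.discriminant (ModularGroup.S • τ) =
      (τ : ℂ) ^ 12 * ModularForm.discriminant τ := by
    rw [discriminant_smul]
    simp [ModularGroup.S]
  rw [thetaQuot, thetaQuot, h_disc, coe_S_smul, thetaPow_neg_inv hl _ _ τ.ne_zero,
    mul_pow (_ ^ 12), ← pow_mul, mul_div_mul_left _ _ (pow_ne_zero _ τ.ne_zero)]

lemma exists_thetaQuot_smul (γ : SL(2, ℤ)) (a b : ℤ) :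
    ∃ a' b' : ℤ, ∀ τ : ℍ, thetaQuot l a b (γ • τ) = thetaQuot l a' b' τ := by
  have hγ : γ ∈ Subgroup.closure {ModularGroup.S, ModularGroup.T} :=
    SpecialLinearGroup.SL2Z_generators ▸ Subgroup.mem_top γ
  induction hγ using Subgroup.closure_induction_left generalizing a b with
  | one => exact ⟨a, b, fun τ => by rw [one_smul]⟩
  | mul_left x hx y _ ih =>
    rcases hx with rfl | rfl
    · obtain ⟨a', b', h⟩ := ih b (-a)
      exact ⟨a', b', fun τ => by rw [mul_smul, thetaQuot_S_smul hl, h]⟩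
    · obtain ⟨a', b', h⟩ := ih a (b + a + l)
      exact ⟨a', b', fun τ => by rw [mul_smul, thetaQuot_T_smul hl, h]⟩
  | inv_mul_cancel x hx y _ ih =>
    rcases hx with rfl | rfl
    · obtain ⟨a', b', h⟩ := ih (-b) a
      refine ⟨a', b', fun τ => ?_⟩
      rw [← h, ← smul_inv_smul ModularGroup.S (y • τ), thetaQuot_S_smul hl, neg_neg, mul_smul]
    · obtain ⟨a', b', h⟩ := ih a (b - a - l)
      refine ⟨a', b', fun τ => ?_⟩
      have h_shift : b - a - l + a + l = b := by ring
      rw [← h, ← smul_inv_smul ModularGroup.T (y • τ), thetaQuot_T_smul hl, h_shift, mul_smul]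

lemma exists_thetaPow_smul (γ : SL(2, ℤ)) (a b : ℤ) :
    ∃ a' b' : ℤ, ∀ τ : ℍ, thetaPow l a b (γ • τ : ℍ) =
      ((γ 1 0 : ℂ) * τ + γ 1 1) ^ (12 * (2 * l) ^ 2) * thetaPow l a' b' τ := by
  obtain ⟨a', b', h⟩ := exists_thetaQuot_smul hl γ a b
  refine ⟨a', b', fun τ => ?_⟩
  have h_quot := h τ
  have h_disc := ModularForm.discriminant_ne_zero τ
  have h_denom := denom_SL_ne_zero γ τ
  rw [thetaQuot, thetaQuot, discriminant_smul, mul_pow, ← pow_mul] at h_quot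
  field_simp at h_quot
  exact h_quot

end ModularGroup

section Hecke

variable {m : ℤ}

/-- The image `(B₀₀ τ + B₀₁) / B₁₁` of `τ` under an upper triangular matrix `B`. -/
def upperTriangularMap (B : FixedDetMatrix (Fin 2) ℤ m) (τ : ℂ) : ℂ :=
  ((B.1 0 0 : ℂ) * τ + B.1 0 1) / B.1 1 1

lemma im_upperTriangularMap (B : FixedDetMatrix (Fin 2) ℤ m) (τ : ℂ) :
    (upperTriangularMap B τ).im = B.1 0 0 / B.1 1 1 * τ.im := by
  rw [upperTriangularMap, Complex.div_intCast_im, Complex.add_im, Complex.intCast_im, add_zero,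
    ← Complex.ofReal_intCast, Complex.im_ofReal_mul]
  ring

lemma reps_apply_one_one_pos (hm : 0 < m) {B : FixedDetMatrix (Fin 2) ℤ m}
    (hB : B ∈ FixedDetMatrices.reps m) : 0 < B.1 1 1 := by
  have h_det := B.2
  rw [Matrix.det_fin_two, hB.1, mul_zero, sub_zero] at h_det
  exact pos_of_mul_pos_right (hm.trans_eq h_det.symm) hB.2.1.le

lemma reps_ratio_pos (hm : 0 < m) {B : FixedDetMatrix (Fin 2) ℤ m}
    (hB : B ∈ FixedDetMatrices.reps m) : (0 : ℝ) < B.1 0 0 / B.1 1 1 :=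
  div_pos (Int.cast_pos.2 hB.2.1) (Int.cast_pos.2 (reps_apply_one_one_pos hm hB))

lemma exists_eq_smul_reps (hm : m ≠ 0) (A : FixedDetMatrix (Fin 2) ℤ m) :
    ∃ γ : SL(2, ℤ), ∃ B ∈ FixedDetMatrices.reps m, A = γ • B := by
  induction A using FixedDetMatrices.induction_on hm with
  | h0 A h₁₀ h₀₀ h₀₁ h_lt => exact ⟨1, A, ⟨h₁₀, h₀₀, h₀₁, h_lt⟩, (one_smul _ _).symm⟩
  | hS A ih =>
    obtain ⟨γ, B, hB, rfl⟩ := ih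
    exact ⟨ModularGroup.S * γ, B, hB, (mul_smul _ _ _).symm⟩
  | hT A ih =>
    obtain ⟨γ, B, hB, rfl⟩ := ih
    exact ⟨ModularGroup.T * γ, B, hB, (mul_smul _ _ _).symm⟩

/-- The entries of the factorisation `diag(N, 1) γ = g B` with `B` among the representatives of the
matrices of determinant `N` modulo the modular group. -/
lemma exists_reps_entries {N : ℕ} (hN : N ≠ 0) (γ : SL(2, ℤ)) :
    ∃ g : SL(2, ℤ), ∃ B ∈ FixedDetMatrices.reps (N : ℤ),
      N * γ 0 0 = g 0 0 * B.1 0 0 ∧ N * γ 0 1 = g 0 0 * B.1 0 1 + g 0 1 * B.1 1 1 ∧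
      γ 1 0 = g 1 0 * B.1 0 0 ∧ γ 1 1 = g 1 0 * B.1 0 1 + g 1 1 * B.1 1 1 := by
  have hγ := γ.det_coe
  rw [Matrix.det_fin_two] at hγ
  have h_det : !![N * γ 0 0, N * γ 0 1; γ 1 0, γ 1 1].det = N := by
    rw [Matrix.det_fin_two_of]
    linear_combination (N : ℤ) * hγ
  obtain ⟨g, B, hB, h_eq⟩ := exists_eq_smul_reps (Nat.cast_ne_zero.2 hN) ⟨_, h_det⟩
  refine ⟨g, B, hB, ?_⟩
  have h_matrix := congrArg Subtype.val h_eq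
  rw [FixedDetMatrices.smul_coe, ← Matrix.ext_iff] at h_matrix
  simpa [Fin.forall_fin_two, Matrix.mul_apply, Fin.sum_univ_two, hB.1, and_assoc] using h_matrix

lemma exists_mul_coe_smul_eq {N : ℕ} (hN : N ≠ 0) (γ : SL(2, ℤ)) :
    ∃ g : SL(2, ℤ), ∃ B ∈ FixedDetMatrices.reps (N : ℤ), ∀ τ : ℍ, ∃ w : ℍ,
      (w : ℂ) = upperTriangularMap B τ ∧ (N : ℂ) * (γ • τ : ℍ) = (g • w : ℍ) ∧
      (γ 1 0 : ℂ) * τ + γ 1 1 = B.1 1 1 * ((g 1 0 : ℂ) * w + g 1 1) := by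
  obtain ⟨g, B, hB, h₀₀, h₀₁, h₁₀, h₁₁⟩ := exists_reps_entries hN γ
  have hN_pos : (0 : ℤ) < N := by exact_mod_cast Nat.pos_of_ne_zero hN
  refine ⟨g, B, hB, fun τ => ⟨⟨upperTriangularMap B τ, ?_⟩, rfl, ?_⟩⟩
  · rw [im_upperTriangularMap]
    exact mul_pos (reps_ratio_pos hN_pos hB) τ.im_pos
  have hB_ne : (B.1 1 1 : ℂ) ≠ 0 := Int.cast_ne_zero.2 (reps_apply_one_one_pos hN_pos hB).ne'
  have h_num : (N : ℂ) * ((γ 0 0 : ℂ) * τ + γ 0 1) =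
      B.1 1 1 * ((g 0 0 : ℂ) * upperTriangularMap B τ + g 0 1) := by
    have h₀₀' : (N : ℂ) * γ 0 0 = g 0 0 * B.1 0 0 := by exact_mod_cast h₀₀
    have h₀₁' : (N : ℂ) * γ 0 1 = g 0 0 * B.1 0 1 + g 0 1 * B.1 1 1 := by exact_mod_cast h₀₁
    rw [upperTriangularMap]
    field_simp
    linear_combination (τ : ℂ) * h₀₀' + h₀₁'
  have h_denom : (γ 1 0 : ℂ) * τ + γ 1 1 =
      B.1 1 1 * ((g 1 0 : ℂ) * upperTriangularMap B τ + g 1 1) := by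
    rw [upperTriangularMap, h₁₀, h₁₁]
    push_cast
    field_simp
    ring
  refine ⟨?_, h_denom⟩
  rw [coe_SL_smul, coe_SL_smul, ← mul_div_assoc, h_num, h_denom, mul_div_mul_left _ _ hB_ne]

/-- The weight zero quotients which are the conjugates of
`τ ↦ thetaPow l a b (N τ) / Δ(τ) ^ (2l)²` under the modular group, for `B` of determinant `N`. -/
def thetaConj (l : ℕ) (B : FixedDetMatrix (Fin 2) ℤ m) (a b : ℤ) (τ : ℍ) : ℂ :=
  thetaPow l a b (upperTriangularMap B τ) /
    ((B.1 1 1 : ℂ) ^ (12 * (2 * l) ^ 2) * ModularForm.discriminant τ ^ (2 * l) ^ 2)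

lemma exists_thetaConj_eq {l N : ℕ} (hl : l ≠ 0) (hN : N ≠ 0) (a b : ℤ) (γ : SL(2, ℤ)) :
    ∃ B ∈ FixedDetMatrices.reps (N : ℤ), ∃ a' b' : ℤ, ∀ τ : ℍ,
      thetaPow l a b (N * (γ • τ : ℍ)) / ModularForm.discriminant (γ • τ) ^ (2 * l) ^ 2 =
        thetaConj l B a' b' τ := by
  obtain ⟨g, B, hB, h_point⟩ := exists_mul_coe_smul_eq hN γ
  obtain ⟨a', b', h_theta⟩ := exists_thetaPow_smul hl g a b
  refine ⟨B, hB, a', b', fun τ => ?_⟩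
  obtain ⟨w, hw, h_smul, h_denom⟩ := h_point τ
  have h_denom_ne := pow_ne_zero (12 * (2 * l) ^ 2) (denom_SL_ne_zero g w)
  rw [h_smul, h_theta, discriminant_smul, h_denom, thetaConj, ← hw, mul_pow (_ ^ 12), ← pow_mul,
    mul_pow (B.1 1 1 : ℂ), mul_comm ((B.1 1 1 : ℂ) ^ _), mul_assoc,
    mul_div_mul_left _ _ h_denom_ne]

lemma finite_range_thetaConj {l : ℕ} (hl : l ≠ 0) (B : FixedDetMatrix (Fin 2) ℤ m) :
    (Set.range fun p : ℤ × ℤ => thetaConj l B p.1 p.2).Finite :=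
  finite_range_of_periodic (mul_ne_zero two_ne_zero hl)
    (fun b a => funext fun _ => congrArg (· / _) (thetaPow_periodic_left hl b _ a))
    (fun a b => funext fun _ => congrArg (· / _) (thetaPow_periodic_right hl a _ b))

lemma isBigO_inv_discriminant :
    (fun τ : ℍ => (ModularForm.discriminant τ)⁻¹) =O[UpperHalfPlane.atImInfty]
      fun τ => Real.exp (2 * Real.pi * τ.im) := by
  have h := ModularForm.exp_isBigO_discriminant.inv_rev
    (Eventually.of_forall fun τ h_exp => absurd h_exp (Real.exp_ne_zero _))
  refine h.congr_right fun τ => ?_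
  rw [← Real.exp_neg]
  congr 1
  ring

lemma isBigO_thetaConj (l : ℕ) (hm : 0 < m) {B : FixedDetMatrix (Fin 2) ℤ m}
    (hB : B ∈ FixedDetMatrices.reps m) (a b : ℤ) :
    thetaConj l B a b =O[UpperHalfPlane.atImInfty]
      fun τ => Real.exp (2 * Real.pi * τ.im) ^ (2 * l) ^ 2 := by
  obtain ⟨C, hC⟩ := exists_norm_thetaPow_le (l := l) a b (reps_ratio_pos hm hB)
  have h_theta : (fun τ : ℍ => thetaPow l a b (upperTriangularMap B τ))
      =O[UpperHalfPlane.atImInfty] fun _ => (1 : ℝ) := by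
    refine UpperHalfPlane.isBoundedAtImInfty_iff.2 ⟨C, 1, fun τ hτ => hC _ ?_⟩
    rw [im_upperTriangularMap]
    exact le_mul_of_one_le_right (reps_ratio_pos hm hB).le hτ
  have h_const := Asymptotics.isBigO_const_const ((B.1 1 1 : ℂ) ^ (12 * (2 * l) ^ 2))⁻¹
    (one_ne_zero (α := ℝ)) UpperHalfPlane.atImInfty
  refine ((h_theta.mul (h_const.mul (isBigO_inv_discriminant.pow ((2 * l) ^ 2)))).congr
    (fun τ => ?_) fun τ => ?_)
  · rw [thetaConj, div_eq_mul_inv, mul_inv, inv_pow]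
  · rw [one_mul, one_mul]

end Hecke

/-! ### A criterion for modular functions -/

section Criterion

lemma finite_setOf_pow_eq {n : ℕ} (hn : 0 < n) (c : ℂ) : {z : ℂ | z ^ n = c}.Finite := by
  refine ((Polynomial.nthRoots n c).toFinset.finite_toSet).subset fun z hz => ?_
  simpa [Polynomial.mem_nthRoots hn] using hz

lemma eq_of_pow_eq_of_eq_at {X : Type*} [TopologicalSpace X] [PreconnectedSpace X] {n : ℕ}
    (hn : 0 < n) {f g : X → ℂ} (hf : Continuous f) (hg : Continuous g) (hg_ne : ∀ x, g x ≠ 0)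
    (h_pow : ∀ x, f x ^ n = g x ^ n) {x₀ : X} (h₀ : f x₀ = g x₀) : f = g := by
  have h_root : Set.MapsTo (fun x => f x / g x) Set.univ {z : ℂ | z ^ n = 1} := fun x _ => by
    rw [Set.mem_ofPred_eq, div_pow, h_pow, div_self (pow_ne_zero _ (hg_ne x))]
  obtain ⟨z, -, hz⟩ := isPreconnected_univ.eqOn_const_of_mapsTo
    (finite_setOf_pow_eq hn 1).isDiscrete (hf.div hg hg_ne).continuousOn h_root ⟨1, one_pow n⟩
  have hz_one : z = 1 := by
    rw [← div_self (hg_ne x₀)]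
    exact (hz (Set.mem_univ x₀)).symm.trans (congrArg (· / g x₀) h₀)
  funext x
  rw [← div_eq_one_iff_eq (hg_ne x), ← hz_one]
  exact hz (Set.mem_univ x)

/-- A translate of `f` is determined by its `n`-th power and its value at `x₀`, so that `f` has
only finitely many translates. -/
lemma exists_finiteIndex_of_finite_pow {G X : Type*} [Group G] [MulAction G X]
    [TopologicalSpace X] [PreconnectedSpace X] [ContinuousConstSMul G X] [Nonempty X] {n : ℕ}
    (hn : 0 < n) {f : X → ℂ} (hf : Continuous f) (hf_ne : ∀ x, f x ≠ 0) {S : Set (X → ℂ)}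
    (hS : S.Finite) (h : ∀ γ : G, (fun x => f (γ • x) ^ n) ∈ S) :
    ∃ Γ : Subgroup G, Γ.FiniteIndex ∧ ∀ γ ∈ Γ, ∀ x, f (γ • x) = f x := by
  let : MulAction G (X → ℂ) := arrowAction
  obtain ⟨x₀⟩ := ‹Nonempty X›
  have h_orbit : (MulAction.orbit G f).Finite := by
    have h_prod : (S ×ˢ ⋃ s ∈ S, {z : ℂ | z ^ n = s x₀}).Finite :=
      hS.prod (hS.biUnion fun s _ => finite_setOf_pow_eq hn _)
    refine Set.Finite.of_finite_image (f := fun k : X → ℂ => (fun x => k x ^ n, k x₀))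
      (h_prod.subset ?_) ?_
    · rintro _ ⟨_, ⟨γ, rfl⟩, rfl⟩
      exact ⟨h γ⁻¹, Set.mem_biUnion (h γ⁻¹) rfl⟩
    · rintro _ ⟨γ, rfl⟩ _ ⟨γ', rfl⟩ h_eq
      obtain ⟨h_pow, h_value⟩ := Prod.mk.inj h_eq
      exact eq_of_pow_eq_of_eq_at hn (hf.comp (continuous_const_smul γ⁻¹))
        (hf.comp (continuous_const_smul γ'⁻¹)) (fun x => hf_ne _) (congrFun h_pow) h_value
  refine ⟨MulAction.stabilizer G f, ⟨?_⟩, fun γ hγ x => ?_⟩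
  · rw [MulAction.index_stabilizer]
    exact ((Set.ncard_pos h_orbit).2 ⟨f, MulAction.mem_orbit_self f⟩).ne'
  · have h_inv : f (γ⁻¹⁻¹ • x) = f x := congrFun (inv_mem hγ : γ⁻¹ • f = f) x
    rwa [inv_inv] at h_inv

variable {l N : ℕ} (hl : l ≠ 0) (hN : N ≠ 0) {a b : ℤ} {f : ℍ → ℂ}
  (h_pow : ∀ τ : ℍ, f τ ^ (24 * (2 * l) ^ 2) =
    thetaPow l a b (N * τ) / ModularForm.discriminant τ ^ (2 * l) ^ 2)
include hl hN h_pow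

lemma exists_finiteIndex_invariant_of_pow_eq (hf : Continuous f) (hf_ne : ∀ τ, f τ ≠ 0) :
    ∃ Γ : Subgroup SL(2, ℤ), Γ.FiniteIndex ∧ ∀ γ ∈ Γ, ∀ τ : ℍ, f (γ • τ) = f τ := by
  have : ContinuousConstSMul SL(2, ℤ) ℍ :=
    ⟨fun γ => continuous_const_smul (γ : GL (Fin 2) ℝ)⟩
  have h_finite := (Set.toFinite (FixedDetMatrices.reps (N : ℤ))).biUnion
    fun B _ => finite_range_thetaConj hl B
  refine exists_finiteIndex_of_finite_pow (n := 24 * (2 * l) ^ 2) (by positivity) hf hf_ne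
    h_finite fun γ => ?_
  obtain ⟨B, hB, a', b', h⟩ := exists_thetaConj_eq hl hN a b γ
  exact Set.mem_biUnion hB ⟨(a', b'), funext fun τ => ((h_pow _).trans (h τ)).symm⟩

omit hl hN h_pow in
lemma norm_exp_two_pi_mul (τ : ℂ) :
    ‖Complex.exp (2 * Real.pi * Complex.I * τ)‖ = Real.exp (-(2 * Real.pi * τ.im)) := by
  have h_real : 2 * Real.pi * Complex.I * τ = ((2 * Real.pi : ℝ) : ℂ) * (Complex.I * τ) := by
    push_cast
    ring
  rw [Complex.norm_exp, h_real, Complex.re_ofReal_mul, Complex.I_mul_re, mul_neg]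

lemma isBoundedAtImInfty_exp_mul_of_pow_eq (γ : SL(2, ℤ)) :
    UpperHalfPlane.IsBoundedAtImInfty fun τ : ℍ =>
      Complex.exp (2 * Real.pi * Complex.I * τ) * f (γ • τ) := by
  obtain ⟨B, hB, a', b', h⟩ := exists_thetaConj_eq hl hN a b γ
  have hN_pos : (0 : ℤ) < N := by exact_mod_cast Nat.pos_of_ne_zero hN
  have h_exponent : 24 * (2 * l) ^ 2 ≠ 0 := by positivity
  have h_exp : (fun τ : ℍ => Complex.exp (2 * Real.pi * Complex.I * τ) ^ (24 * (2 * l) ^ 2))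
      =O[UpperHalfPlane.atImInfty] fun τ => Real.exp (-(2 * Real.pi * τ.im)) ^ (2 * l) ^ 2 := by
    refine .of_norm_le fun τ => ?_
    rw [norm_pow, norm_exp_two_pi_mul]
    refine pow_le_pow_of_le_one (Real.exp_pos _).le ?_ (by lia)
    have := τ.im_pos
    exact Real.exp_le_one_iff.2 (neg_nonpos.2 (by positivity))
  refine Asymptotics.IsBigO.of_pow h_exponent
    ((h_exp.mul (isBigO_thetaConj l hN_pos hB a' b')).congr (fun τ => ?_) fun τ => ?_)
  · rw [Pi.pow_apply, mul_pow (Complex.exp _), h_pow, h]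
  · rw [← mul_pow, ← Real.exp_add, neg_add_cancel, Real.exp_zero, one_pow]
    exact (one_pow _).symm

theorem isModularFunction_of_pow_eq (hf : MDifferentiable 𝓘(ℂ) 𝓘(ℂ) f) (hf_ne : ∀ τ, f τ ≠ 0) :
    IsModularFunction f := by
  refine ⟨hf, exists_finiteIndex_invariant_of_pow_eq hl hN h_pow hf.continuous hf_ne,
    fun γ => ⟨1, ?_⟩⟩
  simpa only [Nat.cast_one, mul_one] using isBoundedAtImInfty_exp_mul_of_pow_eq hl hN h_pow γ

end Criterion

/-- Since `η ^ 24` is the discriminant, a power of the quotient is of the form required by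
`isModularFunction_of_pow_eq`. -/
theorem isModularFunction_thetaChar_div_eta {l N : ℕ} (hl : l ≠ 0) (hN : N ≠ 0) (a b : ℤ)
    (h_ne : ∀ τ : ℍ, thetaChar ((a : ℂ) / (2 * l)) ((b : ℂ) / (2 * l)) (N * τ) ≠ 0) :
    IsModularFunction fun τ : ℍ =>
      thetaChar ((a : ℂ) / (2 * l)) ((b : ℂ) / (2 * l)) (N * τ) / ModularForm.eta τ := by
  have h_eta_ne (τ : ℍ) : ModularForm.eta τ ≠ 0 := ModularForm.eta_ne_zero τ.2
  refine isModularFunction_of_pow_eq hl hN (a := a) (b := b) (fun τ => ?_) ?_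
    fun τ => div_ne_zero (h_ne τ) (h_eta_ne τ)
  · rw [div_pow, ModularForm.discriminant, ← pow_mul]
    rfl
  · rw [UpperHalfPlane.mdifferentiable_iff]
    have h_diff : DifferentiableOn ℂ (fun z : ℂ =>
        thetaChar ((a : ℂ) / (2 * l)) ((b : ℂ) / (2 * l)) (N * z) / ModularForm.eta z)
        {z | 0 < z.im} := fun z hz => by
      have h_im : 0 < ((N : ℂ) * z).im := by
        rw [← Complex.ofReal_natCast, Complex.im_ofReal_mul]
        exact mul_pos (Nat.cast_pos.2 (Nat.pos_of_ne_zero hN)) hz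
      have h_theta := (differentiableAt_thetaChar ((a : ℂ) / (2 * l)) ((b : ℂ) / (2 * l))
        h_im).comp z (f := fun z : ℂ => (N : ℂ) * z) (by fun_prop)
      exact (h_theta.div (ModularForm.differentiableAt_eta_of_mem_upperHalfPlaneSet hz)
        (ModularForm.eta_ne_zero hz)).differentiableWithinAt
    refine h_diff.congr fun z hz => ?_
    rw [Function.comp_apply, UpperHalfPlane.ofComplex_apply_of_im_pos hz]

/-! ### Theta products -/

section Products

lemma norm_exp_two_pi_mul_lt_one {τ : ℂ} (hτ : 0 < τ.im) :
    ‖Complex.exp (2 * Real.pi * Complex.I * τ)‖ < 1 := by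
  rw [norm_exp_two_pi_mul, Real.exp_lt_one_iff, neg_lt_zero]
  positivity

lemma exp_two_pi_mul_pow (τ : ℂ) (n : ℕ) :
    Complex.exp (2 * Real.pi * Complex.I * τ) ^ n =
      Complex.exp (2 * Real.pi * Complex.I * (n * τ)) := by
  rw [← Complex.exp_nat_mul]
  congr 1
  ring

lemma im_natCast_mul_pos {n : ℕ} (hn : n ≠ 0) {τ : ℂ} (hτ : 0 < τ.im) : 0 < ((n : ℂ) * τ).im := by
  rw [← Complex.ofReal_natCast, Complex.im_ofReal_mul]
  exact mul_pos (Nat.cast_pos.2 (Nat.pos_of_ne_zero hn)) hτ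

lemma jacobiTerm_exp (x y : ℂ) (n : ℤ) :
    jacobiTerm (Complex.exp (2 * Real.pi * Complex.I * x))
        (Complex.exp (2 * Real.pi * Complex.I * y)) n =
      jacobiTheta₂_term n (1 / 2 + (x - y) / 2) (x + y) := by
  have h_sign : ((-1 : ℂ)) ^ n.natAbs = Complex.exp (Real.pi * Complex.I * n) := by
    rw [mul_comm, Complex.exp_int_mul, Complex.exp_pi_mul_I]
    rcases n.natAbs_eq with h | h <;> conv_rhs => rw [h]
    · rw [zpow_natCast]
    · rw [zpow_neg, zpow_natCast, ← inv_pow, inv_neg_one]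
  have h_pos : (triangle n : ℂ) * 2 = n * (n + 1) := by exact_mod_cast triangle_mul_two n
  have h_neg : (triangle (-n) : ℂ) * 2 = -n * (-n + 1) := by exact_mod_cast triangle_mul_two (-n)
  rw [jacobiTerm, jacobiTheta₂_term, h_sign, ← Complex.exp_nat_mul, ← Complex.exp_nat_mul,
    ← Complex.exp_add, ← Complex.exp_add]
  congr 1
  linear_combination Real.pi * Complex.I * (x * h_pos + y * h_neg)

theorem jacobiTheta₂_eq_qPochInf₃ {x y X Y : ℂ} (hx : 0 < x.im) (hy : 0 < y.im)
    (hX : X = Complex.exp (2 * Real.pi * Complex.I * x))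
    (hY : Y = Complex.exp (2 * Real.pi * Complex.I * y)) :
    jacobiTheta₂ (1 / 2 + (x - y) / 2) (x + y) = qPochInf₃ X Y (X * Y) (X * Y) := by
  subst hX hY
  exact ((hasSum_jacobiTerm (norm_exp_two_pi_mul_lt_one hx)
    (norm_exp_two_pi_mul_lt_one hy)).congr_fun fun n => (jacobiTerm_exp x y n).symm).tsum_eq

lemma eta_eq_qPochInf (τ : ℂ) {q : ℂ} (hq : q = Complex.exp (2 * Real.pi * Complex.I * τ)) :
    ModularForm.eta τ = Complex.exp (2 * Real.pi * Complex.I * τ / 24) * qPochInf q q := by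
  rw [ModularForm.eta, qPochInf, Function.Periodic.qParam]
  congr 1
  refine tprod_congr fun n => ?_
  rw [ModularForm.eta_q_eq_pow, ← hq, pow_succ']

variable {u v : ℕ} (hu : u ≠ 0) (hv : v ≠ 0)
include hu hv

/-- The second characteristic is `1 / 2`, over the common denominator for which
`isModularFunction_thetaChar_div_eta` is stated. -/
lemma thetaChar_eq_exp_mul_qPochInf₃ (τ : ℍ) {q : ℂ}
    (hq : q = Complex.exp (2 * Real.pi * Complex.I * τ)) :
    thetaChar (((u - v : ℤ) : ℂ) / (2 * (u + v : ℕ))) (((u + v : ℤ) : ℂ) / (2 * (u + v : ℕ)))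
        ((u + v : ℕ) * τ) =
      Complex.exp (2 * Real.pi * Complex.I * ((u - v) ^ 2 / (8 * (u + v))) * τ) *
        qPochInf₃ (q ^ u) (q ^ v) (q ^ (u + v)) (q ^ (u + v)) := by
  have h_sum_ne : (u : ℂ) + v ≠ 0 := by
    exact_mod_cast (by omega : u + v ≠ 0)
  have h_theta := jacobiTheta₂_eq_qPochInf₃ (im_natCast_mul_pos hu τ.im_pos)
    (im_natCast_mul_pos hv τ.im_pos) (exp_two_pi_mul_pow τ u) (exp_two_pi_mul_pow τ v)
  rw [← hq, ← pow_add] at h_theta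
  rw [← h_theta, thetaChar]
  push_cast
  congr 2
  · field_simp
    ring
  · field_simp
    ring
  · ring

/-- The power of `q` by which the quotient of `(q^u, q^v, q^{u+v}; q^{u+v})_∞` by `(q; q)_∞` has
to be multiplied to become a modular function. -/
def productShift (u v : ℕ) : ℚ := (u - v) ^ 2 / (8 * (u + v)) - 1 / 24

theorem isModularFunction_qPochInf₃_div_qPochInf :
    IsModularFunction fun τ : ℍ =>
      Complex.exp (2 * Real.pi * Complex.I * productShift u v * τ) *
        (qPochInf₃ (Complex.exp (2 * Real.pi * Complex.I * τ) ^ u)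
          (Complex.exp (2 * Real.pi * Complex.I * τ) ^ v)
          (Complex.exp (2 * Real.pi * Complex.I * τ) ^ (u + v))
          (Complex.exp (2 * Real.pi * Complex.I * τ) ^ (u + v)) /
        qPochInf (Complex.exp (2 * Real.pi * Complex.I * τ))
          (Complex.exp (2 * Real.pi * Complex.I * τ))) := by
  have huv : u + v ≠ 0 := by omega
  have h_modular := isModularFunction_thetaChar_div_eta huv huv (u - v) (u + v) fun τ => by
    have h_norm {n : ℕ} (hn : n ≠ 0) :=
      norm_pow_lt_one (norm_exp_two_pi_mul_lt_one τ.im_pos) hn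
    rw [thetaChar_eq_exp_mul_qPochInf₃ hu hv τ rfl]
    exact mul_ne_zero (Complex.exp_ne_zero _) (mul_ne_zero (mul_ne_zero
      (qPochInf_ne_zero (h_norm hu) (h_norm huv)) (qPochInf_ne_zero (h_norm hv) (h_norm huv)))
      (qPochInf_ne_zero (h_norm huv) (h_norm huv)))
  convert h_modular using 2 with τ
  rw [thetaChar_eq_exp_mul_qPochInf₃ hu hv τ rfl, eta_eq_qPochInf _ rfl, mul_div_mul_comm,
    ← Complex.exp_sub, productShift]
  congr 2
  push_cast
  ring

end Products

/-! ### Nahm sums of index `(1, 1, 2)` -/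

section QuadraticForms

lemma posDef_of_complete_squares {p r s : ℝ} (hp : 0 < p) (hr : 0 < r) (hs : 0 < s)
    (α β γ : ℝ) :
    (!![p, p * α, p * β;
        α * p, α * p * α + r, α * p * β + r * γ;
        β * p, β * p * α + γ * r, β * p * β + γ * r * γ + s]).PosDef := by
  let L : Matrix (Fin 3) (Fin 3) ℝ := !![1, α, β; 0, 1, γ; 0, 0, 1]
  have hL : IsUnit L := by
    rw [Matrix.isUnit_iff_isUnit_det, Matrix.det_fin_three]
    simp [L]
  have h_diagonal : (Matrix.diagonal ![p, r, s]).PosDef := by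
    refine .diagonal fun i => ?_
    fin_cases i <;> assumption
  convert h_diagonal.conjTranspose_mul_mul_same (Matrix.mulVec_injective_of_isUnit hL) using 1
  ext i j
  fin_cases i <;> fin_cases j <;> simp [L, Matrix.mul_apply, Fin.sum_univ_three]

lemma mul_diagonal_one_one_two (a b c d e f g h i : ℚ) :
    !![a, b, c; d, e, f; g, h, i] * Matrix.diagonal (fun i => ((![1, 1, 2] : Fin 3 → ℕ) i : ℚ)) =
      !![a, b, c * 2; d, e, f * 2; g, h, i * 2] := by
  ext j k
  rw [Matrix.mul_diagonal]
  fin_cases j <;> fin_cases k <;> simp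

lemma posDef_matrix₁ : ((!![1, 1, 0; 1, 2, 1; 0, 2, 4] *
    Matrix.diagonal (fun i => ((![1, 1, 2] : Fin 3 → ℕ) i : ℚ))).map
      (fun x : ℚ => (x : ℝ))).PosDef := by
  rw [mul_diagonal_one_one_two]
  convert posDef_of_complete_squares (p := 1) (r := 1) (s := 4) (by norm_num) (by norm_num)
    (by norm_num) 1 0 2 using 1
  ext i j
  fin_cases i <;> fin_cases j <;> norm_num

lemma posDef_matrix₆ : ((!![1, 1, 1; 1, 5, 4; 2, 8, 8] *
    Matrix.diagonal (fun i => ((![1, 1, 2] : Fin 3 → ℕ) i : ℚ))).map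
      (fun x : ℚ => (x : ℝ))).PosDef := by
  rw [mul_diagonal_one_one_two]
  convert posDef_of_complete_squares (p := 1) (r := 4) (s := 3) (by norm_num) (by norm_num)
    (by norm_num) 1 2 (3 / 2) using 1
  ext i j
  fin_cases i <;> fin_cases j <;> norm_num

lemma posDef_matrix₇ : ((!![1, 1, 0; 1, 8, 1; 0, 2, 1] *
    Matrix.diagonal (fun i => ((![1, 1, 2] : Fin 3 → ℕ) i : ℚ))).map
      (fun x : ℚ => (x : ℝ))).PosDef := by
  rw [mul_diagonal_one_one_two]
  convert posDef_of_complete_squares (p := 1) (r := 7) (s := 10 / 7) (by norm_num) (by norm_num)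
    (by norm_num) 1 0 (2 / 7) using 1
  ext i j
  fin_cases i <;> fin_cases j <;> norm_num

lemma posDef_matrix₁₀ : ((!![2, 1, 1; 1, 4, 1; 2, 2, 2] *
    Matrix.diagonal (fun i => ((![1, 1, 2] : Fin 3 → ℕ) i : ℚ))).map
      (fun x : ℚ => (x : ℝ))).PosDef := by
  rw [mul_diagonal_one_one_two]
  convert posDef_of_complete_squares (p := 2) (r := 7 / 2) (s := 12 / 7) (by norm_num)
    (by norm_num) (by norm_num) (1 / 2) 1 (2 / 7) using 1
  ext i j
  fin_cases i <;> fin_cases j <;> norm_num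

lemma nahmExponent_one_one_two (a b c d e f g h i x y z : ℚ) (n : Fin 3 → ℕ) :
    nahmExponent !![a, b, c; d, e, f; g, h, i] ![x, y, z] 0 ![1, 1, 2] n =
      1 / 2 * (a * n 0 ^ 2 + e * n 1 ^ 2 + 2 * i * n 2 ^ 2 + (b + d) * (n 0 * n 1) +
        (2 * c + g) * (n 0 * n 2) + (2 * f + h) * (n 1 * n 2)) +
      (x * n 0 + y * n 1 + z * n 2) := by
  rw [nahmExponent, mul_diagonal_one_one_two]
  simp only [dotProduct, Matrix.mulVec, Matrix.of_apply, Matrix.cons_val', Matrix.cons_val_fin_one,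
    Fin.sum_univ_three, Matrix.cons_val_zero, Matrix.cons_val_one, Matrix.cons_val]
  ring

end QuadraticForms

section Modularity

/-- Functions on a set with three elements as triples. -/
def finThreeArrowEquivProd : (Fin 3 → ℕ) ≃ ℕ × ℕ × ℕ where
  toFun n := (n 0, n 1, n 2)
  invFun p := ![p.1, p.2.1, p.2.2]
  left_inv n := by
    ext i
    fin_cases i <;> rfl
  right_inv _ := rfl

variable {A : Matrix (Fin 3) (Fin 3) ℚ} {b : Fin 3 → ℚ} {N : ℕ → ℕ → ℕ → ℕ} {e u v : ℕ}

lemma nahmSum_eq_of_hasSum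
    (hN : ∀ n, nahmExponent A b 0 ![1, 1, 2] n = N (n 0) (n 1) (n 2)) (c : ℚ) (τ : ℍ) {q P : ℂ}
    (hq : q = Complex.exp (2 * Real.pi * Complex.I * τ)) (h : HasSum (index112Term q N) P) :
    nahmSum A b c ![1, 1, 2] τ = Complex.exp (2 * Real.pi * Complex.I * c * τ) * P := by
  have h_shift := (finThreeArrowEquivProd.hasSum_iff.2 h).mul_left
    (Complex.exp (2 * Real.pi * Complex.I * c * τ))
  have h_pow (m : ℕ) : Complex.exp (2 * Real.pi * Complex.I * m * τ) = q ^ m := by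
    rw [hq, exp_two_pi_mul_pow, mul_assoc]
  refine (h_shift.congr_fun fun n => ?_).tsum_eq
  have h_exponent : nahmExponent A b c ![1, 1, 2] n = c + N (n 0) (n 1) (n 2) := by
    rw [← hN, nahmExponent, nahmExponent, add_zero, add_comm]
  rw [h_exponent]
  push_cast
  rw [mul_add, add_mul, Complex.exp_add, h_pow, Fin.prod_univ_three, h_pow, h_pow, h_pow,
    mul_div_assoc]
  simp only [Matrix.cons_val_zero, Matrix.cons_val_one, Matrix.cons_val, pow_one]
  rfl

theorem exists_isModularQuadruple (hu : u ≠ 0) (hv : v ≠ 0)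
    (hA : ((A * Matrix.diagonal (fun i => ((![1, 1, 2] : Fin 3 → ℕ) i : ℚ))).map
      (fun x : ℚ => (x : ℝ))).PosDef)
    (hN : ∀ n, nahmExponent A b 0 ![1, 1, 2] n = N (n 0) (n 1) (n 2))
    (h : ∀ q : ℂ, ‖q‖ < 1 → HasSum (index112Term q N)
      (qPochInf₃ (q ^ u) (q ^ v) (q ^ (u + v)) (q ^ (u + v)) / qPochInf q q)) :
    ∃ c : ℚ, IsModularQuadruple A b c ![1, 1, 2] := by
  have h_sum : nahmSum A b (productShift u v) ![1, 1, 2] = _ := funext fun τ =>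
    nahmSum_eq_of_hasSum hN _ τ rfl (h _ (norm_exp_two_pi_mul_lt_one τ.im_pos))
  refine ⟨productShift u v, fun i => ?_, hA, ?_⟩
  · fin_cases i <;> simp
  · rw [h_sum]
    exact isModularFunction_qPochInf₃_div_qPochInf hu hv

namespace IsRogersRamanujan

variable (h : IsRogersRamanujan e u v) (hu : u ≠ 0) (hv : v ≠ 0)
include h hu hv

theorem exists_isModularQuadruple₁ :
    ∃ c : ℚ, IsModularQuadruple !![1, 1, 0; 1, 2, 1; 0, 2, 4] ![1 / 2, 1, 4 * e] c ![1, 1, 2] := by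
  refine exists_isModularQuadruple (mul_ne_zero four_ne_zero hu) (mul_ne_zero four_ne_zero hv)
    posDef_matrix₁ (N := exponent₁ e) (fun n => ?_) fun q hq => ?_
  · rw [nahmExponent_one_one_two, exponent₁_cast]
    ring
  · simpa only [mul_add] using h.hasSum_exponent₁ hq

theorem exists_isModularQuadruple₆ :
    ∃ c : ℚ, IsModularQuadruple !![1, 1, 1; 1, 5, 4; 2, 8, 8] ![1 / 2, 2 * e - 1 / 2, 4 * e] c
      ![1, 1, 2] := by
  refine exists_isModularQuadruple (mul_ne_zero two_ne_zero hu) (mul_ne_zero two_ne_zero hv)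
    posDef_matrix₆ (N := exponent₆ e) (fun n => ?_) fun q hq => ?_
  · rw [nahmExponent_one_one_two, exponent₆_cast]
    ring
  · simpa only [mul_add] using h.hasSum_exponent₆ hq

theorem exists_isModularQuadruple₇ :
    ∃ c : ℚ, IsModularQuadruple !![1, 1, 0; 1, 8, 1; 0, 2, 1] ![1 / 2, 4 * e, 1] c ![1, 1, 2] := by
  refine exists_isModularQuadruple (mul_ne_zero four_ne_zero hu) (mul_ne_zero four_ne_zero hv)
    posDef_matrix₇ (N := exponent₇ e) (fun n => ?_) fun q hq => ?_
  · rw [nahmExponent_one_one_two, exponent₇_cast]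
    ring
  · simpa only [mul_add] using h.hasSum_exponent₇ hq

theorem exists_isModularQuadruple₁₀ :
    ∃ c : ℚ, IsModularQuadruple !![2, 1, 1; 1, 4, 1; 2, 2, 2] ![0, 2 * e, 1] c ![1, 1, 2] := by
  refine exists_isModularQuadruple (mul_ne_zero two_ne_zero hu) (mul_ne_zero two_ne_zero hv)
    posDef_matrix₁₀ (N := exponent₁₀ e) (fun n => ?_) fun q hq => ?_
  · rw [nahmExponent_one_one_two, exponent₁₀_cast]
    ring
  · simpa only [mul_add] using h.hasSum_exponent₁₀ hq

end IsRogersRamanujan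

end Modularity

end

theorem mainTheorem9 :
    (∀ q : ℂ, ‖q‖ < 1 →
      HasIndex112Sum q (fun i j k =>
          1 / 2 * i ^ 2 + j ^ 2 + 4 * k ^ 2 + i * j + 2 * j * k + 1 / 2 * i + j)
        (qPochInf₃ (q ^ 8) (q ^ 12) (q ^ 20) (q ^ 20) / qPochInf q q) ∧
      HasIndex112Sum q (fun i j k =>
          1 / 2 * i ^ 2 + j ^ 2 + 4 * k ^ 2 + i * j + 2 * j * k + 1 / 2 * i + j + 4 * k)
        (qPochInf₃ (q ^ 4) (q ^ 16) (q ^ 20) (q ^ 20) / qPochInf q q) ∧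
      HasIndex112Sum q (fun i j k =>
          1 / 2 * i ^ 2 + 5 / 2 * j ^ 2 + 8 * k ^ 2 + i * j + 2 * i * k + 8 * j * k + 1 / 2 * i - 1 / 2 * j)
        (qPochInf₃ (q ^ 4) (q ^ 6) (q ^ 10) (q ^ 10) / qPochInf q q) ∧
      HasIndex112Sum q (fun i j k =>
          1 / 2 * i ^ 2 + 5 / 2 * j ^ 2 + 8 * k ^ 2 + i * j + 2 * i * k + 8 * j * k + 1 / 2 * i + 3 / 2 * j + 4 * k)
        (qPochInf₃ (q ^ 2) (q ^ 8) (q ^ 10) (q ^ 10) / qPochInf q q) ∧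
      HasIndex112Sum q (fun i j k =>
          1 / 2 * i ^ 2 + 4 * j ^ 2 + k ^ 2 + i * j + 2 * j * k + 1 / 2 * i + k)
        (qPochInf₃ (q ^ 8) (q ^ 12) (q ^ 20) (q ^ 20) / qPochInf q q) ∧
      HasIndex112Sum q (fun i j k =>
          1 / 2 * i ^ 2 + 4 * j ^ 2 + k ^ 2 + i * j + 2 * j * k + 1 / 2 * i + 4 * j + k)
        (qPochInf₃ (q ^ 4) (q ^ 16) (q ^ 20) (q ^ 20) / qPochInf q q) ∧
      HasIndex112Sum q (fun i j k =>
          i ^ 2 + 2 * j ^ 2 + 2 * k ^ 2 + i * j + 2 * i * k + 2 * j * k + k)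
        (qPochInf₃ (q ^ 4) (q ^ 6) (q ^ 10) (q ^ 10) / qPochInf q q) ∧
      HasIndex112Sum q (fun i j k =>
          i ^ 2 + 2 * j ^ 2 + 2 * k ^ 2 + i * j + 2 * i * k + 2 * j * k + 2 * j + k)
        (qPochInf₃ (q ^ 2) (q ^ 8) (q ^ 10) (q ^ 10) / qPochInf q q)) ∧
    (∃ c : ℚ, IsModularQuadruple !![1, 1, 0; 1, 2, 1; 0, 2, 4] ![1 / 2, 1, 0] c ![1, 1, 2]) ∧
    (∃ c : ℚ, IsModularQuadruple !![1, 1, 0; 1, 2, 1; 0, 2, 4] ![1 / 2, 1, 4] c ![1, 1, 2]) ∧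
    (∃ c : ℚ, IsModularQuadruple !![1, 1, 1; 1, 5, 4; 2, 8, 8] ![1 / 2, -1 / 2, 0] c ![1, 1, 2]) ∧
    (∃ c : ℚ, IsModularQuadruple !![1, 1, 1; 1, 5, 4; 2, 8, 8] ![1 / 2, 3 / 2, 4] c ![1, 1, 2]) ∧
    (∃ c : ℚ, IsModularQuadruple !![1, 1, 0; 1, 8, 1; 0, 2, 1] ![1 / 2, 0, 1] c ![1, 1, 2]) ∧
    (∃ c : ℚ, IsModularQuadruple !![1, 1, 0; 1, 8, 1; 0, 2, 1] ![1 / 2, 4, 1] c ![1, 1, 2]) ∧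
    (∃ c : ℚ, IsModularQuadruple !![2, 1, 1; 1, 4, 1; 2, 2, 2] ![0, 0, 1] c ![1, 1, 2]) ∧
    (∃ c : ℚ, IsModularQuadruple !![2, 1, 1; 1, 4, 1; 2, 2, 2] ![0, 2, 1] c ![1, 1, 2]) := by
  have h₀ := isRogersRamanujan_zero
  have h₁ := isRogersRamanujan_one
  refine ⟨fun q hq => ⟨?_, ?_, ?_, ?_, ?_, ?_, ?_, ?_⟩, ?_, ?_, ?_, ?_, ?_, ?_, ?_, ?_⟩
  · simpa using h₀.hasIndex112Sum₁ hq
  · simpa using h₁.hasIndex112Sum₁ hq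
  · simpa [← sub_eq_add_neg] using h₀.hasIndex112Sum₆ hq
  · convert h₁.hasIndex112Sum₆ hq using 6 <;> norm_num
  · simpa using h₀.hasIndex112Sum₇ hq
  · simpa using h₁.hasIndex112Sum₇ hq
  · simpa using h₀.hasIndex112Sum₁₀ hq
  · simpa using h₁.hasIndex112Sum₁₀ hq
  · simpa using h₀.exists_isModularQuadruple₁ two_ne_zero three_ne_zero
  · simpa using h₁.exists_isModularQuadruple₁ one_ne_zero four_ne_zero
  · simpa [neg_div] using h₀.exists_isModularQuadruple₆ two_ne_zero three_ne_zero
  · convert h₁.exists_isModularQuadruple₆ one_ne_zero four_ne_zero using 6 <;> norm_num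
  · simpa using h₀.exists_isModularQuadruple₇ two_ne_zero three_ne_zero
  · simpa using h₁.exists_isModularQuadruple₇ one_ne_zero four_ne_zero
  · simpa using h₀.exists_isModularQuadruple₁₀ two_ne_zero three_ne_zero
  · simpa using h₁.exists_isModularQuadruple₁₀ one_ne_zero four_ne_zero
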